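/- Let $\mathbb D$ be the open unit disc of $\mathbb C$, $dA=\frac{dx\,dy}{\pi}$, and let $\omega=e^{-2\varphi}$ be a smooth rapidly decreasing weight on $\mathbb D$, which means the following: (a) $\varphi$ is a radial positive $C^2$ function on $\mathbb D$, increasing on $[0,1)$, with $\Delta\varphi>0$ on $\mathbb D$; (b) there are a positive decreasing $C^1$ function $\tau$ on $[0,1)$ with $\lim_{r\to1^-}\tau(r)=\lim_{r\to1^-}\tau'(r)=0$ and constants $a,b>0$ such that $a\,\tau(|z|)\le(\Delta\varphi(z))^{-1/2}\le b\,\tau(|z|)$ for all $z\in\mathbb D$; (c) either there is $C_0>0$ such that $\tau(r)(1-r)^{-C_0}$ increases for $r$ close to $1$, or $\lim_{r\to1^-}\tau'(r)\log\frac1{\tau(r)}=0$; (d) $\varphi$ is convex on $[0,1)$, and there are $\eta,K>0$ such that $(1+\varphi'(s))\,\tau(s)^\eta\le K\,(1+\varphi'(t))\,\tau(t)^\eta$ whenever $0\le t\le s<1$. For $0<p<\infty$ put $\omega_p=\omega^{p/2}$, let $L^p_{\omega_p}$ be the space of measurable functions $f$ on $\mathbb D$ with $\|f\|_{L^p_{\omega_p}}^p=\int_{\mathbb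 D}|f|^p\,\omega_p\,dA<\infty$, and let $A^p_{\omega_p}$ be its subspace of analytic functions, with the same (quasi-)norm. For $g$ analytic on $\mathbb D$ let $T_gf(z)=\int_0^z f(\zeta)g'(\zeta)\,d\zeta$ for every $f$ analytic on $\mathbb D$, and for $q\ge1$ define $\|g\|_{\mathscr B^q_\varphi}\in[0,\infty]$ by $$\|g\|_{\mathscr B^q_\varphi}^q=\sup_{z\in\mathbb D}\frac{|\nabla|g|^q|(z)}{1+\varphi'(|z|)},\qquad |\nabla\psi|(z)=\limsup_{w\to z}\frac{|\psi(w)-\psi(z)|}{|w-z|}.$$ Let $\omega=e^{-2\varphi}$ be as above, $0<p<\infty$, $\sigma\in\mathbb Q$ with $\sigma>0$, $\ell\in\mathbb N$ with $\ell\ge1$, and $s=\sigma+1$. Then there is a constant $C>0$, depending only on $\omega,p,\sigma$ and $\ell$, such that for every function $g$ analytic on a neighbourhood of the closed disc $\overline{\mathbb D}$ the operator $$Q_g^{\sigma,\ell}f=|g|^{\sigma\ell}\,T_g^{\ell}f$$ is a bounded linear operator from $A^p_{\omega_p}$ to $L^p_{\omega_p}$, and its norm $\|Q_g^{\sigma,\ell}\|_{L^p_{\omega_p}}=\sup\{\|Q_g^{\sigma,\ell}f\|_{L^p_{\omega_p}}:f\in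 A^p_{\omega_p},\ \|f\|_{A^p_{\omega_p}}=1\}$ satisfies $$\|Q_g^{\sigma,\ell}\|_{L^p_{\omega_p}}\le C\,\|g\|_{\mathscr B^s_\varphi}^{s\ell}.$$ -/

import Mathlib

open MeasureTheory Filter Topology Set
open scoped ENNReal NNReal

noncomputable section

namespace Paraproduct

/-- The open unit disc. -/
def disc : Set ℂ := Metric.ball (0 : ℂ) 1

/-- For a radial function `φ` on the disc, the derivative `φ'(r)` of its radial profile
`r ↦ φ(r)`. Being the restriction of `φ` to the real diameter, the profile is defined on
`(-1, 1)`, so that this is a two-sided derivative also at `r = 0`. -/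
def radialDeriv (φ : ℂ → ℝ) (r : ℝ) : ℝ := deriv (fun t : ℝ => φ (t : ℂ)) r

/-- `ω = e^{-2φ}` is a smooth rapidly decreasing weight on the unit disc. -/
structure IsSmoothRapidlyDecreasing (φ : ℂ → ℝ) : Prop where
  radial : ∀ z ∈ disc, ∀ w ∈ disc, ‖z‖ = ‖w‖ → φ z = φ w
  pos : ∀ z ∈ disc, 0 < φ z
  contDiff : ContDiffOn ℝ 2 φ disc
  monotone : MonotoneOn (fun r : ℝ => φ (r : ℂ)) (Ico 0 1)
  laplacian_pos : ∀ z ∈ disc, 0 < Laplacian.laplacian φ z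
  convex : ConvexOn ℝ (Ico 0 1) (fun r : ℝ => φ (r : ℂ))
  exists_tau : ∃ τ : ℝ → ℝ,
    (∀ r ∈ Ico (0 : ℝ) 1, 0 < τ r) ∧
    AntitoneOn τ (Ico 0 1) ∧
    ContDiffOn ℝ 1 τ (Ico 0 1) ∧
    Tendsto τ (𝓝[<] 1) (𝓝 0) ∧
    Tendsto (deriv τ) (𝓝[<] 1) (𝓝 0) ∧
    -- `(Δφ)^{-1/2} ≃ τ` on the disc
    (∃ a b : ℝ, 0 < a ∧ 0 < b ∧ ∀ z ∈ disc,
      a * τ ‖z‖ ≤ (Laplacian.laplacian φ z) ^ (-(1 / 2) : ℝ) ∧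
      (Laplacian.laplacian φ z) ^ (-(1 / 2) : ℝ) ≤ b * τ ‖z‖) ∧
    ((∃ C : ℝ, 0 < C ∧ ∃ r₀ ∈ Ico (0 : ℝ) 1,
        MonotoneOn (fun r : ℝ => τ r * (1 - r) ^ (-C)) (Ico r₀ 1)) ∨
      Tendsto (fun r : ℝ => deriv τ r * Real.log (1 / τ r)) (𝓝[<] 1) (𝓝 0)) ∧
    -- `(1 + φ') τ^η` is essentially decreasing
    (∃ η : ℝ, 0 < η ∧ ∃ K : ℝ, 0 < K ∧ ∀ t s : ℝ, 0 ≤ t → t ≤ s → s < 1 →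
      (1 + radialDeriv φ s) * τ s ^ η ≤ K * ((1 + radialDeriv φ t) * τ t ^ η))

/-- The weight `ω = e^{-2φ}`. -/
def weight (φ : ℂ → ℝ) (z : ℂ) : ℝ := Real.exp (-2 * φ z)

/-- The weight `ω_p = ω^{p/2}`. -/
def weightP (φ : ℂ → ℝ) (p : ℝ) (z : ℂ) : ℝ := weight φ z ^ (p / 2)

/-- The measure `v dA` on the unit disc, where `dA = dx dy / π`. -/
def weightedArea (v : ℂ → ℝ) : Measure ℂ :=
  (volume.restrict disc).withDensity (fun z => ENNReal.ofReal (v z / Real.pi))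

/-- The (quasi-)norm of `L^p_v`: `(∫_𝔻 |f|^p v dA)^{1/p}`, with values in `[0, ∞]`. -/
def lpNorm (p : ℝ) (v : ℂ → ℝ) (f : ℂ → ℂ) : ℝ≥0∞ :=
  eLpNorm f (ENNReal.ofReal p) (weightedArea v)

/-- The weighted Lebesgue space `L^p_v` on the disc. -/
def lebesgue (p : ℝ) (v : ℂ → ℝ) : Set (ℂ → ℂ) :=
  {f | MemLp f (ENNReal.ofReal p) (weightedArea v)}

/-- The weighted Bergman space `A^p_v`: the functions analytic on the disc that are in `L^p_v`
(values outside the disc are irrelevant). -/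
def bergman (p : ℝ) (v : ℂ → ℝ) : Set (ℂ → ℂ) :=
  {f | AnalyticOnNhd ℂ f disc ∧ f ∈ lebesgue p v}

/-- The paraproduct `T_g f (z) = ∫_0^z f(ζ) g'(ζ) dζ`, integrated along the segment `[0, z]`. -/
def T (g f : ℂ → ℂ) (z : ℂ) : ℂ :=
  ∫ t in (0 : ℝ)..1, f (t * z) * deriv g (t * z) * z

/-- `Q_g^{σ,ℓ} f = |g|^{σℓ} T_g^ℓ f`. -/
def Q (g : ℂ → ℂ) (σ : ℚ) (l : ℕ) (f : ℂ → ℂ) (z : ℂ) : ℂ :=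
  ((‖g z‖ ^ ((σ : ℝ) * l) : ℝ) : ℂ) * ((T g)^[l] f) z

/-- `|∇ψ|(z) = limsup_{w → z} |ψ(w) - ψ(z)| / |w - z|`, with values in `[0, ∞]`. -/
def gradNorm (ψ : ℂ → ℝ) (z : ℂ) : ℝ≥0∞ :=
  limsup (fun w : ℂ => ENNReal.ofReal (|ψ w - ψ z| / ‖w - z‖)) (𝓝[≠] z)

/-- `‖g‖` in the Bloch-type class of order `q`, with values in `[0, ∞]`:
`‖g‖^q = sup_{z ∈ 𝔻} |∇|g|^q|(z) / (1 + φ'(|z|))`. -/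
def blochNorm (φ : ℂ → ℝ) (q : ℝ) (g : ℂ → ℂ) : ℝ≥0∞ :=
  (⨆ z ∈ disc, gradNorm (fun w => ‖g w‖ ^ q) z /
    ENNReal.ofReal (1 + radialDeriv φ ‖z‖)) ^ (1 / q)

/-- `L` is a bounded linear operator from `A^p_v` to `L^p_v` (functions on the disc). -/
structure IsBoundedOperator (p : ℝ) (v : ℂ → ℝ) (L : (ℂ → ℂ) → (ℂ → ℂ)) : Prop where
  map_mem : ∀ f ∈ bergman p v, L f ∈ lebesgue p v
  map_add : ∀ f ∈ bergman p v, ∀ h ∈ bergman p v, ∀ z ∈ disc, L (f + h) z = L f z + L h z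
  map_smul : ∀ c : ℂ, ∀ f ∈ bergman p v, ∀ z ∈ disc, L (c • f) z = c * L f z
  bound : ∃ M : ℝ≥0, ∀ f ∈ bergman p v, lpNorm p v (L f) ≤ M * lpNorm p v f

/-- The operator norm `sup {‖L f‖_{L^p_v} : f ∈ A^p_v, ‖f‖_{A^p_v} = 1}`, in `[0, ∞]`. -/
def opNorm (p : ℝ) (v : ℂ → ℝ) (L : (ℂ → ℂ) → (ℂ → ℂ)) : ℝ≥0∞ :=
  ⨆ f ∈ {f | f ∈ bergman p v ∧ lpNorm p v f = 1}, lpNorm p v (L f)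

end Paraproduct

end

/-!
Put `F_k = T_g^k f` and let `B` be an upper bound for `|g|^σ |g'| / (1 + φ')`; as
`|∇|g|^{σ+1}| ≥ (σ+1) |g|^σ |g'|` (`ofReal_le_gradNorm`), every `B` above the `(σ+1)`-st power of
the Bloch-type norm will do. Everything happens at the scale `η = K / (N + φ')`, with `K` large
depending on `p` and then `N` large depending on `K` and `φ`. The condition `τ' → 0` gives
`φ'' = o(φ'²)` at the boundary, so that `η` has small Lipschitz constant and `η ‖z‖` is small
compared with the distance from `z` to the boundary
(`IsSmoothRapidlyDecreasing.exists_isRadialScale`). On discs of radius a few multiples of `η` both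
`η` and the weight `e^{-pΦ}`, `Φ(r) = φ(r) + N r`, are essentially constant, while one step of
length `η` towards the origin multiplies the weight by at least `e^{pK/2}`. Since `N r` is bounded,
`e^{-pΦ}` may replace `e^{-pφ}`.

The analytic core is a one-sided Littlewood–Paley inequality (`lintegral_norm_rpow_le_deriv`): if
`F(0) = 0`, then `∫ |F|^p V e^{-pΦ} ≤ C ∫ |F'|^p η^p V e^{-pΦ}` for every `p > 0`, with the same `C`
for all factors `V` that vary by at most a factor `2` on discs of radius `4η`. To see this, compare
`|F|^p` at `re^{iθ}` with its value at `(r - η(r)) e^{iθ}`. The gain in the weight turns the shifted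
term into at most half of the left-hand side, and the increment of `F` is controlled by the
`p`-mean of `F'` over a disc of radius `4η`, by subharmonicity of `|F'|^p`
(`norm_rpow_mul_volume_le`, a consequence of Jensen's formula).

The Bloch-type condition with exponent `σ` self-improves to `|g'| η ≤ C A`, where `A^{σ+1} = K B`
(`norm_deriv_mul_scale_le`). Therefore `H = max (|g|, M A)` with `M` large dominates `|g|`,
satisfies `H^σ |g'| η ≤ C B`, and `V = H^{pσk}` is an admissible factor for all `k ≤ ℓ`
(`exists_regularised_modulus`). Applying the inequality to `F_{k+1}`, whose derivative is `F_k g'`,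
gives `∫ |F_{k+1}|^p H^{pσ(k+1)} e^{-pΦ} ≤ C B^p ∫ |F_k|^p H^{pσk} e^{-pΦ}`, and iterating `ℓ` times
bounds `|g|^{σℓ} |F_ℓ|`.
-/

noncomputable section

namespace Paraproduct

/-! ### Polar coordinates and the mean value inequality for `|f|^p` -/

/-- Integration over a disc in polar coordinates. -/
theorem lintegral_ball_polar (c : ℂ) (R : ℝ) (f : ℂ → ℝ≥0∞) :
    ∫⁻ z in Metric.ball c R, f z = ∫⁻ q in Ioo 0 R ×ˢ Ioo (-Real.pi) Real.pi,
      ENNReal.ofReal q.1 * f (circleMap c q.1 q.2) := by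
  have h1 : ∫⁻ z in Metric.ball c R, f z
      = ∫⁻ z, (Metric.ball (0 : ℂ) R).indicator (fun z => f (c + z)) z := by
    rw [← lintegral_indicator measurableSet_ball, ← lintegral_add_left_eq_self _ c]
    congr 1; ext z
    simp [indicator]
  rw [h1, ← Complex.lintegral_comp_polarCoord_symm,
    ← lintegral_indicator polarCoord.open_target.measurableSet,
    ← lintegral_indicator (measurableSet_Ioo.prod measurableSet_Ioo)]
  congr 1; ext ⟨r, θ⟩
  have he : (r : ℂ) * (Real.cos θ + Real.sin θ * Complex.I) = r * Complex.exp (θ * Complex.I) := by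
    rw [Complex.exp_mul_I]; push_cast; rfl
  by_cases hr : 0 < r
  · by_cases hθ : θ ∈ Ioo (-Real.pi) Real.pi
    · rw [indicator_of_mem (by simpa [polarCoord_target] using ⟨hr, hθ⟩)]
      by_cases hrR : r < R
      · rw [indicator_of_mem (s := Ioo 0 R ×ˢ _) (by exact ⟨⟨hr, hrR⟩, hθ⟩),
          indicator_of_mem (by simp [abs_of_pos hr, hrR])]
        simp only [Complex.polarCoord_symm_apply, he, circleMap, smul_eq_mul]
      · rw [indicator_of_notMem (s := Ioo 0 R ×ˢ _) (by rintro ⟨⟨_, h⟩, _⟩; exact hrR h),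
          indicator_of_notMem (by simpa [abs_of_pos hr] using hrR)]
        simp
    · rw [indicator_of_notMem (by rintro ⟨_, h⟩; exact hθ h),
        indicator_of_notMem (by rintro ⟨_, h⟩; exact hθ h)]
  · rw [indicator_of_notMem (by rintro ⟨h, _⟩; exact hr h),
      indicator_of_notMem (by rintro ⟨⟨h, _⟩, _⟩; exact hr h)]

theorem measurable_polar_integrand (c : ℂ) {f : ℂ → ℝ≥0∞} (hf : Measurable f) :
    Measurable fun q : ℝ × ℝ => ENNReal.ofReal q.1 * f (circleMap c q.1 q.2) := by
  refine measurable_fst.ennreal_ofReal.mul (hf.comp ?_)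
  unfold circleMap
  fun_prop

theorem lintegral_ball_eq_lintegral_radius (c : ℂ) (R : ℝ) {f : ℂ → ℝ≥0∞} (hf : Measurable f) :
    ∫⁻ z in Metric.ball c R, f z = ∫⁻ r in Ioo 0 R, ENNReal.ofReal r *
      ∫⁻ θ in Ioo (-Real.pi) Real.pi, f (circleMap c r θ) := by
  rw [lintegral_ball_polar c R f, Measure.volume_eq_prod, ← Measure.prod_restrict,
    lintegral_prod _ (measurable_polar_integrand c hf).aemeasurable]
  refine lintegral_congr fun r => ?_
  exact lintegral_const_mul' _ _ ENNReal.ofReal_ne_top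

theorem lintegral_ball_eq_lintegral_angle (c : ℂ) (R : ℝ) {f : ℂ → ℝ≥0∞} (hf : Measurable f) :
    ∫⁻ z in Metric.ball c R, f z = ∫⁻ θ in Ioo (-Real.pi) Real.pi, ∫⁻ r in Ioo 0 R,
      ENNReal.ofReal r * f (circleMap c r θ) := by
  rw [lintegral_ball_polar c R f, Measure.volume_eq_prod, ← Measure.prod_restrict,
    lintegral_prod_symm _ (measurable_polar_integrand c hf).aemeasurable]

/-- Subharmonicity of `log |f|`: in Jensen's formula the contribution of the zeros is nonnegative. -/
theorem log_norm_le_circleAverage {c : ℂ} {R : ℝ} (hR : 0 < R) {f : ℂ → ℂ}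
    (hf : AnalyticOnNhd ℂ f (Metric.closedBall c R)) (h0 : f c ≠ 0) :
    Real.log ‖f c‖ ≤ Real.circleAverage (Real.log ‖f ·‖) c R := by
  have habs : |R| = R := abs_of_pos hR
  rw [AnalyticOnNhd.circleAverage_log_norm hR.ne' (by rwa [habs]) h0]
  have : 0 ≤ ∑ᶠ u, (MeromorphicOn.divisor f (Metric.closedBall c |R|) u : ℝ) *
      Real.log (R * ‖c - u‖⁻¹) := by
    refine finsum_nonneg fun u => ?_
    by_cases hu : u ∈ Metric.closedBall c |R|
    · refine mul_nonneg ?_ ?_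
      · exact_mod_cast MeromorphicOn.AnalyticOnNhd.divisor_nonneg (by rwa [habs]) u
      · rw [habs, Metric.mem_closedBall, dist_comm, dist_eq_norm] at hu
        rcases eq_or_ne ‖c - u‖ 0 with h | h
        · simp [h]
        · apply Real.log_nonneg
          rw [← div_eq_mul_inv, one_le_div (by positivity)]
          exact hu
    · simp [hu]
  linarith

/-- Subharmonicity of `|f|^p` for every `p > 0`, obtained from that of `log |f|` by convexity of
`exp`. -/
theorem circleAverage_norm_rpow_ge {c : ℂ} {R p : ℝ} (hR : 0 < R) (hp : 0 < p) {f : ℂ → ℂ}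
    (hf : AnalyticOnNhd ℂ f (Metric.closedBall c R)) :
    ‖f c‖ ^ p ≤ Real.circleAverage (fun z => ‖f z‖ ^ p) c R := by
  have habs : |R| = R := abs_of_pos hR
  have hcont : ContinuousOn (fun z => ‖f z‖ ^ p) (Metric.sphere c |R|) := by
    rw [habs]
    exact ((hf.continuousOn.mono Metric.sphere_subset_closedBall).norm).rpow_const
      fun _ _ => Or.inr hp.le
  rcases eq_or_ne (f c) 0 with h0 | h0
  · rw [h0, norm_zero, Real.zero_rpow hp.ne']
    exact Real.circleAverage_nonneg_of_nonneg fun _ _ => by positivity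
  set A := ‖f c‖ with hA
  have hApos : 0 < A := norm_pos_iff.2 h0
  have hlog := log_norm_le_circleAverage hR hf h0
  have hint : CircleIntegrable (fun z => Real.log ‖f z‖) c R :=
    MeromorphicOn.circleIntegrable_log_norm (by
      rw [habs]; exact (hf.mono Metric.sphere_subset_closedBall).meromorphicOn)
  -- the tangent line of `exp` at `p log |f c|` lies below `exp`
  have key : ∀ x : ℝ, 0 < x → A ^ p * (1 - p * Real.log A) + A ^ p * p * Real.log x ≤ x ^ p := by
    intro x hx
    have h1 := Real.add_one_le_exp (p * Real.log x - p * Real.log A)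
    have h2 : x ^ p = A ^ p * Real.exp (p * Real.log x - p * Real.log A) := by
      rw [Real.exp_sub, Real.rpow_def_of_pos hx, Real.rpow_def_of_pos hApos]
      field_simp
    rw [h2]
    have h3 : 0 < A ^ p := by positivity
    nlinarith
  -- at zeros of `f` the tangent line bound fails, since `Real.log 0 = 0`; they form a discrete set
  have hcod : (fun z => A ^ p * (1 - p * Real.log A) + A ^ p * p * Real.log ‖f z‖)
      =ᶠ[codiscreteWithin (Metric.sphere c |R|)]
      fun z => min (A ^ p * (1 - p * Real.log A) + A ^ p * p * Real.log ‖f z‖) (‖f z‖ ^ p) := by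
    have h := hf.preimage_zero_mem_codiscreteWithin h0
      (Metric.mem_closedBall_self hR.le) ⟨⟨c, Metric.mem_closedBall_self hR.le⟩,
        (convex_closedBall c R).isPreconnected⟩
    have h' := codiscreteWithin_mono (Metric.sphere_subset_closedBall (x := c) (ε := R)) h
    rw [habs]
    filter_upwards [h'] with z hz
    rw [min_eq_left]
    exact key _ (norm_pos_iff.2 (by simpa using hz))
  have hint1 : CircleIntegrable (fun z => A ^ p * p * Real.log ‖f z‖) c R :=
    hint.const_mul (A ^ p * p)
  have hint2 : CircleIntegrable
      (fun z => A ^ p * (1 - p * Real.log A) + A ^ p * p * Real.log ‖f z‖) c R :=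
    (circleIntegrable_const _ _ _).add hint1
  have hint3 : CircleIntegrable (fun z => ‖f z‖ ^ p) c R :=
    ContinuousOn.circleIntegrable' hcont
  calc A ^ p ≤ A ^ p * (1 - p * Real.log A) +
        A ^ p * p * Real.circleAverage (Real.log ‖f ·‖) c R := by
        have h3 : 0 < A ^ p * p := by positivity
        nlinarith [mul_le_mul_of_nonneg_left hlog h3.le]
    _ = Real.circleAverage
          (fun z => A ^ p * (1 - p * Real.log A) + A ^ p * p * Real.log ‖f z‖) c R := by
        rw [Real.circleAverage_fun_add (circleIntegrable_const _ _ _) hint1,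
          Real.circleAverage_const]
        congr 1
        exact (Real.circleAverage_fun_smul (a := A ^ p * p)).symm
    _ = Real.circleAverage (fun z => min (A ^ p * (1 - p * Real.log A) +
          A ^ p * p * Real.log ‖f z‖) (‖f z‖ ^ p)) c R :=
        Real.circleAverage_congr_codiscreteWithin hcod hR.ne'
    _ ≤ _ := Real.circleAverage_mono (by
          have := CircleIntegrable.congr_codiscreteWithin hcod hint2
          exact this) hint3 fun z _ => min_le_right _ _

theorem lintegral_angle_eq_circleAverage {c : ℂ} {R : ℝ} {u : ℂ → ℝ} (h0 : ∀ z, 0 ≤ u z)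
    (hu : CircleIntegrable u c R) :
    ∫⁻ θ in Ioo (-Real.pi) Real.pi, ENNReal.ofReal (u (circleMap c R θ))
      = ENNReal.ofReal (2 * Real.pi * Real.circleAverage u c R) := by
  have hper : Function.Periodic (fun θ => u (circleMap c R θ)) (2 * Real.pi) :=
    fun θ => by simp only [periodic_circleMap c R θ]
  have hI : IntegrableOn (fun θ => u (circleMap c R θ)) (Ioo (-Real.pi) Real.pi) := by
    have h1 : IntervalIntegrable (fun θ => u (circleMap c R θ)) volume 0 (2 * Real.pi) := hu
    have h2 := hper.intervalIntegrable (t := 0) (by positivity) (by simpa using h1)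
      (-Real.pi) Real.pi
    rw [intervalIntegrable_iff_integrableOn_Ioo_of_le (by linarith [Real.pi_pos])] at h2
    exact h2
  rw [← ofReal_integral_eq_lintegral_ofReal hI (ae_of_all _ fun _ => h0 _),
    ← integral_Ioc_eq_integral_Ioo, ← intervalIntegral.integral_of_le (by linarith [Real.pi_pos]),
    Real.circleAverage_def]
  congr 1
  have h3 := hper.intervalIntegral_add_eq 0 (-Real.pi)
  rw [zero_add, show -Real.pi + 2 * Real.pi = Real.pi by ring] at h3
  rw [← h3, smul_eq_mul]
  field_simp

theorem measurable_indicator_of_continuousOn {β : Type*} [TopologicalSpace β] [MeasurableSpace β]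
    [BorelSpace β] [Zero β] {s : Set ℂ} (hs : MeasurableSet s) {f : ℂ → β}
    (hf : ContinuousOn f s) : Measurable (s.indicator f) := by
  classical
  rw [← piecewise_eq_indicator]
  exact hf.measurable_piecewise continuousOn_const hs

/-- The area mean value inequality for `|f|^p`, valid for every exponent `p > 0`. -/
theorem norm_rpow_mul_volume_le {c : ℂ} {t p : ℝ} (hp : 0 < p) {f : ℂ → ℂ}
    (hf : AnalyticOnNhd ℂ f (Metric.ball c t)) :
    ENNReal.ofReal (‖f c‖ ^ p) * volume (Metric.ball c t)
      ≤ ∫⁻ z in Metric.ball c t, ENNReal.ofReal (‖f z‖ ^ p) := by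
  have hcont : ContinuousOn (fun z => ENNReal.ofReal (‖f z‖ ^ p)) (Metric.ball c t) :=
    ENNReal.continuous_ofReal.comp_continuousOn
      (hf.continuousOn.norm.rpow_const fun _ _ => Or.inr hp.le)
  have hm := measurable_indicator_of_continuousOn measurableSet_ball hcont
  rw [← setLIntegral_const, lintegral_ball_eq_lintegral_radius c t measurable_const,
    ← setLIntegral_congr_fun measurableSet_ball (f := (Metric.ball c t).indicator
      fun z => ENNReal.ofReal (‖f z‖ ^ p)) (fun z hz => indicator_of_mem hz _),
    lintegral_ball_eq_lintegral_radius c t hm]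
  refine setLIntegral_mono' measurableSet_Ioo fun r hr => ?_
  gcongr ENNReal.ofReal r * ?_
  have hsub : Metric.closedBall c r ⊆ Metric.ball c t := Metric.closedBall_subset_ball hr.2
  have hfr := hf.mono hsub
  have h1 : ∀ θ : ℝ, (Metric.ball c t).indicator (fun z => ENNReal.ofReal (‖f z‖ ^ p))
      (circleMap c r θ) = ENNReal.ofReal (‖f (circleMap c r θ)‖ ^ p) := fun θ =>
    indicator_of_mem (hsub (circleMap_mem_closedBall c hr.1.le θ)) _
  simp_rw [h1]
  have hcs : CircleIntegrable (fun z => ‖f z‖ ^ p) c r :=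
    ContinuousOn.circleIntegrable hr.1.le
      ((hfr.continuousOn.mono Metric.sphere_subset_closedBall).norm.rpow_const
        fun _ _ => Or.inr hp.le)
  rw [lintegral_angle_eq_circleAverage (u := fun z => ‖f z‖ ^ p) (fun z => by positivity) hcs,
    setLIntegral_const, Real.volume_Ioo, ← ENNReal.ofReal_mul (by positivity)]
  apply ENNReal.ofReal_le_ofReal
  nlinarith [circleAverage_norm_rpow_ge hr.1 hp hfr, Real.pi_pos]

/-! ### Radial length scales -/

/-- A radial weight exponent `Φ` together with a length scale `η` comparable, up to the factor `K`,
to the reciprocal of its slope: `Φ' = K / η`. The derivative of `Φ` enters only through the slope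
bounds, and `η` is so small that discs of radius a few multiples of `η ‖z‖` around `z` stay inside
the unit disc and see `η` as essentially constant. -/
structure IsRadialScale (K : ℝ) (Φ η : ℝ → ℝ) : Prop where
  pos : ∀ r ∈ Ico (0 : ℝ) 1, 0 < η r
  lip : ∀ r ∈ Ico (0 : ℝ) 1, ∀ t ∈ Ico (0 : ℝ) 1, |η r - η t| ≤ |r - t| / 16
  le : ∀ r ∈ Ico (0 : ℝ) 1, η r ≤ (1 - r) / 16
  anti : AntitoneOn η (Ico 0 1)
  diff : ∀ r ∈ Ioo (0 : ℝ) 1, DifferentiableAt ℝ η r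
  cont : ContinuousOn Φ (Ico 0 1)
  slope_ge : ∀ t r : ℝ, 0 ≤ t → t ≤ r → r < 1 → K * ((r - t) / η t) ≤ Φ r - Φ t
  slope_le : ∀ t r : ℝ, 0 ≤ t → t ≤ r → r < 1 → Φ r - Φ t ≤ K * ((r - t) / η r)

theorem norm_mem_Ico {z : ℂ} (hz : z ∈ disc) : ‖z‖ ∈ Ico (0 : ℝ) 1 :=
  ⟨norm_nonneg z, by simpa [disc] using hz⟩

theorem isOpen_disc : IsOpen disc := Metric.isOpen_ball

theorem measurableSet_disc : MeasurableSet disc := isOpen_disc.measurableSet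

namespace IsRadialScale

variable {K : ℝ} {Φ η : ℝ → ℝ}

theorem continuousOn_scale (h : IsRadialScale K Φ η) : ContinuousOn η (Ico 0 1) := by
  have : LipschitzOnWith (1 / 16 : ℝ≥0) η (Ico 0 1) := by
    refine LipschitzOnWith.of_dist_le_mul fun x hx y hy => ?_
    rw [Real.dist_eq, Real.dist_eq]
    have := h.lip x hx y hy
    push_cast
    linarith
  exact this.continuousOn

theorem continuousOn_scale_norm (h : IsRadialScale K Φ η) :
    ContinuousOn (fun z : ℂ => η ‖z‖) disc :=
  h.continuousOn_scale.comp continuous_norm.continuousOn fun _ hz => norm_mem_Ico hz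

theorem continuousOn_exponent_norm (h : IsRadialScale K Φ η) :
    ContinuousOn (fun z : ℂ => Φ ‖z‖) disc :=
  h.cont.comp continuous_norm.continuousOn fun _ hz => norm_mem_Ico hz

theorem pos_norm (h : IsRadialScale K Φ η) {z : ℂ} (hz : z ∈ disc) : 0 < η ‖z‖ :=
  h.pos _ (norm_mem_Ico hz)

theorem ball_subset_disc (h : IsRadialScale K Φ η) {z : ℂ} (hz : z ∈ disc) :
    Metric.ball z (16 * η ‖z‖) ⊆ disc := by
  intro w hw
  rw [mem_ball_iff_norm] at hw
  have h1 := h.le _ (norm_mem_Ico hz)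
  have h2 := norm_sub_norm_le w z
  simp only [disc, mem_ball_zero_iff]
  linarith

theorem abs_scale_sub_le (h : IsRadialScale K Φ η) {z w : ℂ} (hz : z ∈ disc) (hw : w ∈ disc) :
    |η ‖z‖ - η ‖w‖| ≤ ‖z - w‖ / 16 :=
  (h.lip _ (norm_mem_Ico hz) _ (norm_mem_Ico hw)).trans (by
    have := abs_norm_sub_norm_le z w
    linarith)

/-- The weight `e^{-pΦ}` varies by at most a constant factor on discs of radius `4 η`. -/
theorem exp_exponent_le (h : IsRadialScale K Φ η) (hK : 0 ≤ K) {p : ℝ} (hp : 0 < p) {z w : ℂ}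
    (hz : z ∈ disc) (hw : w ∈ disc) (hzw : ‖z - w‖ ≤ 4 * η ‖z‖) :
    Real.exp (-p * Φ ‖z‖) ≤ Real.exp (6 * p * K) * Real.exp (-p * Φ ‖w‖) := by
  rw [← Real.exp_add]
  apply Real.exp_le_exp.2
  have hηz := h.pos_norm hz
  have hηw := h.pos_norm hw
  suffices hs : Φ ‖w‖ - Φ ‖z‖ ≤ 6 * K by nlinarith
  rcases le_total ‖w‖ ‖z‖ with hle | hle
  · have := h.slope_ge _ _ (norm_nonneg w) hle (norm_mem_Ico hz).2
    have h2 : 0 ≤ K * ((‖z‖ - ‖w‖) / η ‖w‖) :=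
      mul_nonneg hK (div_nonneg (by linarith) hηw.le)
    linarith
  · have := h.slope_le _ _ (norm_nonneg z) hle (norm_mem_Ico hw).2
    refine this.trans ?_
    rw [mul_comm 6 K]
    refine mul_le_mul_of_nonneg_left ?_ hK
    rw [div_le_iff₀ hηw]
    have h1 := abs_le.1 (h.abs_scale_sub_le hz hw)
    have h2 := norm_sub_norm_le w z
    rw [norm_sub_rev] at h2
    linarith

end IsRadialScale

theorem add_rpow_le_two_rpow {a b p : ℝ} (ha : 0 ≤ a) (hb : 0 ≤ b) (hp : 0 < p) :
    (a + b) ^ p ≤ 2 ^ p * (a ^ p + b ^ p) := by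
  have h1 : (a + b) ^ p ≤ (2 * max a b) ^ p := by
    apply Real.rpow_le_rpow (by positivity) _ hp.le
    linarith [le_max_left a b, le_max_right a b]
  rw [Real.mul_rpow (by norm_num) (by positivity)] at h1
  refine h1.trans (mul_le_mul_of_nonneg_left ?_ (by positivity))
  rcases max_cases a b with ⟨h, _⟩ | ⟨h, _⟩ <;> rw [h]
  · linarith [Real.rpow_nonneg hb p]
  · linarith [Real.rpow_nonneg ha p]

/-- The oscillation of an analytic function over a disc of radius `3s` is controlled by the
`p`-mean of its derivative over the disc of radius `4s`, for every `p > 0`. -/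
theorem norm_sub_rpow_le_lintegral {F F' : ℂ → ℂ} {z z' : ℂ} {s p : ℝ} (hp : 0 < p) (hs : 0 < s)
    (hF : ∀ w ∈ Metric.ball z (4 * s), HasDerivAt F (F' w) w)
    (hF' : AnalyticOnNhd ℂ F' (Metric.ball z (4 * s))) (hz' : ‖z' - z‖ ≤ 3 * s) :
    ENNReal.ofReal (‖F z - F z'‖ ^ p) ≤ ENNReal.ofReal (3 ^ p * s ^ p / (Real.pi * s ^ 2)) *
      ∫⁻ w in Metric.ball z (4 * s), ENNReal.ofReal (‖F' w‖ ^ p) := by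
  set G := ∫⁻ w in Metric.ball z (4 * s), ENNReal.ofReal (‖F' w‖ ^ p) with hG
  have hc : 0 < 3 ^ p * s ^ p / (Real.pi * s ^ 2) := by positivity
  rcases eq_or_ne G ⊤ with htop | htop
  · rw [htop, ENNReal.mul_top (by simpa using hc)]
    exact le_top
  have hsub : Metric.closedBall z (3 * s) ⊆ Metric.ball z (4 * s) :=
    Metric.closedBall_subset_ball (by linarith)
  have hbound : ∀ w ∈ Metric.closedBall z (3 * s),
      ‖F' w‖ ≤ (G.toReal / (Real.pi * s ^ 2)) ^ (1 / p) := by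
    intro w hw
    have hball : Metric.ball w s ⊆ Metric.ball z (4 * s) :=
      Metric.ball_subset_ball' (by rw [Metric.mem_closedBall] at hw; linarith)
    have h1 := norm_rpow_mul_volume_le hp (hF'.mono hball)
    have h2 : ENNReal.ofReal (‖F' w‖ ^ p) * volume (Metric.ball w s) ≤ G :=
      h1.trans (lintegral_mono_set hball)
    rw [Complex.volume_ball] at h2
    have h3 := ENNReal.toReal_mono htop h2
    rw [ENNReal.toReal_mul, ENNReal.toReal_mul, ENNReal.toReal_ofReal (by positivity),
      ENNReal.toReal_pow, ENNReal.toReal_ofReal hs.le, ENNReal.coe_toReal, NNReal.coe_real_pi] at h3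
    rw [← Real.rpow_le_rpow_iff (norm_nonneg _) (by positivity) hp, ← Real.rpow_mul (by positivity),
      one_div_mul_cancel hp.ne', Real.rpow_one, le_div_iff₀ (by positivity)]
    linarith
  have hz'm : z' ∈ Metric.closedBall z (3 * s) := by rwa [mem_closedBall_iff_norm]
  have hmv := (convex_closedBall z (3 * s)).norm_image_sub_le_of_norm_hasDerivWithin_le
    (fun w hw => (hF w (hsub hw)).hasDerivWithinAt) hbound hz'm
    (Metric.mem_closedBall_self (by positivity))
  have hmv2 : ‖F z - F z'‖ ≤ (G.toReal / (Real.pi * s ^ 2)) ^ (1 / p) * (3 * s) :=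
    hmv.trans (mul_le_mul_of_nonneg_left (by rwa [norm_sub_rev]) (by positivity))
  have h4 := Real.rpow_le_rpow (norm_nonneg _) hmv2 hp.le
  rw [Real.mul_rpow (by positivity) (by positivity), ← Real.rpow_mul (by positivity),
    one_div_mul_cancel hp.ne', Real.rpow_one, Real.mul_rpow (by norm_num) hs.le] at h4
  rw [← ENNReal.ofReal_toReal htop, ← ENNReal.ofReal_mul hc.le]
  apply ENNReal.ofReal_le_ofReal
  refine h4.trans (le_of_eq ?_)
  ring

/-! ### Averages of the oscillation bound -/

/-- The upper bound for the oscillation of a primitive of `f` over the disc of radius `3 η ‖z‖`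
around `z` given by `norm_sub_rpow_le_lintegral`. -/
def oscBound (η : ℝ → ℝ) (p : ℝ) (f : ℂ → ℂ) (z : ℂ) : ℝ≥0∞ :=
  ENNReal.ofReal (3 ^ p * η ‖z‖ ^ p / (Real.pi * η ‖z‖ ^ 2)) *
    ∫⁻ w in Metric.ball z (4 * η ‖z‖), ENNReal.ofReal (‖f w‖ ^ p)

variable {K : ℝ} {Φ η : ℝ → ℝ}

theorem continuousOn_ofReal_norm_rpow {p : ℝ} (hp : 0 < p) {f : ℂ → ℂ} {s : Set ℂ}
    (hf : ContinuousOn f s) : ContinuousOn (fun z => ENNReal.ofReal (‖f z‖ ^ p)) s :=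
  ENNReal.continuous_ofReal.comp_continuousOn (hf.norm.rpow_const fun _ _ => Or.inr hp.le)

/-- The integrand of `oscBound`, weighted by `a`, as a function of the pair (centre, point). -/
def oscKernel (η : ℝ → ℝ) (p : ℝ) (f : ℂ → ℂ) (a : ℂ → ℝ≥0∞) : ℂ × ℂ → ℝ≥0∞ :=
  {q : ℂ × ℂ | ‖q.2 - q.1‖ < 4 * disc.indicator (fun z => η ‖z‖) q.1}.indicator
    fun q => disc.indicator a q.1 * disc.indicator (fun w => ENNReal.ofReal (‖f w‖ ^ p)) q.2

theorem oscKernel_eq_mul {p : ℝ} {f : ℂ → ℂ} {a : ℂ → ℝ≥0∞} {z w : ℂ} (hz : z ∈ disc)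
    (hw : w ∈ disc) (hzw : ‖w - z‖ < 4 * η ‖z‖) :
    oscKernel η p f a (z, w) = a z * ENNReal.ofReal (‖f w‖ ^ p) := by
  simp [oscKernel, indicator, hz, hw, hzw]

theorem oscKernel_eq_zero {p : ℝ} {f : ℂ → ℂ} {a : ℂ → ℝ≥0∞} {z w : ℂ}
    (hzw : z ∈ disc → w ∈ disc → 4 * η ‖z‖ ≤ ‖w - z‖) : oscKernel η p f a (z, w) = 0 := by
  by_cases hz : z ∈ disc <;> by_cases hw : w ∈ disc <;>
    simp_all [oscKernel, indicator]

theorem measurable_oscKernel (h : IsRadialScale K Φ η) {p : ℝ} (hp : 0 < p) {f : ℂ → ℂ}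
    (hf : ContinuousOn f disc) {a : ℂ → ℝ≥0∞} (ha : ContinuousOn a disc) :
    Measurable (oscKernel η p f a) := by
  refine Measurable.indicator ?_ (measurableSet_lt (by fun_prop) ?_)
  · exact ((measurable_indicator_of_continuousOn measurableSet_disc ha).comp measurable_fst).mul
      ((measurable_indicator_of_continuousOn measurableSet_disc
        (continuousOn_ofReal_norm_rpow hp hf)).comp measurable_snd)
  · exact ((measurable_indicator_of_continuousOn measurableSet_disc
      h.continuousOn_scale_norm).comp measurable_fst).const_mul 4

theorem lintegral_oscKernel (h : IsRadialScale K Φ η) (p : ℝ) (f : ℂ → ℂ) (a : ℂ → ℝ≥0∞)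
    (ha : ∀ z, a z ≠ ⊤) (z : ℂ) :
    ∫⁻ w, oscKernel η p f a (z, w) = disc.indicator (fun z => a z *
        ∫⁻ w in Metric.ball z (4 * η ‖z‖), ENNReal.ofReal (‖f w‖ ^ p)) z := by
  by_cases hz : z ∈ disc
  · rw [indicator_of_mem hz, ← lintegral_const_mul' _ _ (ha z),
      ← lintegral_indicator measurableSet_ball]
    refine lintegral_congr fun w => ?_
    by_cases hw : w ∈ Metric.ball z (4 * η ‖z‖)
    · have hwd : w ∈ disc := h.ball_subset_disc hz
        (Metric.ball_subset_ball (by linarith [h.pos_norm hz]) hw)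
      have hw' : ‖w - z‖ < 4 * η ‖z‖ := by rwa [← mem_ball_iff_norm]
      rw [indicator_of_mem hw, oscKernel_eq_mul hz hwd hw']
    · rw [indicator_of_notMem hw, oscKernel_eq_zero fun _ _ => ?_]
      rwa [mem_ball_iff_norm, not_lt] at hw
  · rw [indicator_of_notMem hz]
    simp [oscKernel_eq_zero (η := η) (p := p) (f := f) (a := a) (fun h => absurd h hz)]

theorem measurable_oscBound_mul (h : IsRadialScale K Φ η) {p : ℝ} (hp : 0 < p) {f : ℂ → ℂ}
    (hf : ContinuousOn f disc) {W : ℂ → ℝ} (hW : ContinuousOn W disc) :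
    Measurable (disc.indicator fun z => oscBound η p f z * ENNReal.ofReal (W z)) := by
  have ha : ContinuousOn (fun z : ℂ => ENNReal.ofReal (3 ^ p * η ‖z‖ ^ p / (Real.pi * η ‖z‖ ^ 2))
      ) disc := by
    refine ENNReal.continuous_ofReal.comp_continuousOn ?_
    refine ContinuousOn.div ?_ ?_ fun z hz => ?_
    · exact continuousOn_const.mul (h.continuousOn_scale_norm.rpow_const fun _ _ => Or.inr hp.le)
    · exact continuousOn_const.mul (h.continuousOn_scale_norm.pow 2)
    · have := h.pos_norm hz
      positivity
  have hm := (measurable_oscKernel h hp hf ha).lintegral_prod_right' (ν := volume)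
  simp_rw [lintegral_oscKernel h p f _ (fun _ => ENNReal.ofReal_ne_top)] at hm
  have hm2 := hm.mul (measurable_indicator_of_continuousOn measurableSet_disc
    (ENNReal.continuous_ofReal.comp_continuousOn hW))
  convert hm2 using 1
  ext z
  by_cases hz : z ∈ disc
  · simp [hz, oscBound]
  · simp [hz]

/-- Integrating `oscBound` against a weight that is essentially constant on discs of radius `4 η`
gives back the integral of `|f|^p η^p`, by Tonelli's theorem. -/
theorem lintegral_oscBound_mul_le (h : IsRadialScale K Φ η) {p c : ℝ} (hp : 0 < p) (hc : 0 < c)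
    {f : ℂ → ℂ} (hf : ContinuousOn f disc) {W : ℂ → ℝ} (hW : ContinuousOn W disc)
    (hW0 : ∀ z ∈ disc, 0 < W z)
    (hWc : ∀ z ∈ disc, ∀ w ∈ disc, ‖z - w‖ ≤ 4 * η ‖z‖ → W z ≤ c * W w) :
    ∫⁻ z in disc, oscBound η p f z * ENNReal.ofReal (W z) ≤
      ENNReal.ofReal (3 ^ p * 2 ^ p * 144 * c) *
        ∫⁻ z in disc, ENNReal.ofReal (‖f z‖ ^ p * η ‖z‖ ^ p * W z) := by
  set a : ℂ → ℝ≥0∞ := fun z =>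
    ENNReal.ofReal (3 ^ p * η ‖z‖ ^ p / (Real.pi * η ‖z‖ ^ 2) * W z) with hadef
  have ha : ContinuousOn a disc := by
    refine ENNReal.continuous_ofReal.comp_continuousOn (ContinuousOn.mul ?_ hW)
    refine ContinuousOn.div ?_ ?_ fun z hz => ?_
    · exact continuousOn_const.mul (h.continuousOn_scale_norm.rpow_const fun _ _ => Or.inr hp.le)
    · exact continuousOn_const.mul (h.continuousOn_scale_norm.pow 2)
    · have := h.pos_norm hz
      positivity
  have hm := measurable_oscKernel h hp hf ha
  calc ∫⁻ z in disc, oscBound η p f z * ENNReal.ofReal (W z)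
      = ∫⁻ z, ∫⁻ w, oscKernel η p f a (z, w) := by
        rw [← lintegral_indicator measurableSet_disc]
        refine lintegral_congr fun z => ?_
        rw [lintegral_oscKernel h p f a (fun _ => ENNReal.ofReal_ne_top)]
        by_cases hz : z ∈ disc
        · have := h.pos_norm hz
          rw [indicator_of_mem hz, indicator_of_mem hz, oscBound, hadef]
          dsimp only
          rw [ENNReal.ofReal_mul (by positivity)]
          ring
        · rw [indicator_of_notMem hz, indicator_of_notMem hz]
    _ = ∫⁻ w, ∫⁻ z, oscKernel η p f a (z, w) :=
        lintegral_lintegral_swap hm.aemeasurable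
    _ ≤ ∫⁻ w, disc.indicator (fun w => ENNReal.ofReal (3 ^ p * 2 ^ p * 144 * c) *
          ENNReal.ofReal (‖f w‖ ^ p * η ‖w‖ ^ p * W w)) w := by
        refine lintegral_mono fun w => ?_
        by_cases hw : w ∈ disc
        · have hηw := h.pos_norm hw
          have hWw := hW0 w hw
          rw [indicator_of_mem hw]
          have hpt : ∀ z, oscKernel η p f a (z, w) ≤
              (Metric.ball w (6 * η ‖w‖)).indicator (fun _ => ENNReal.ofReal
                (3 ^ p * 2 ^ p * 4 * c / Real.pi * (η ‖w‖ ^ p / η ‖w‖ ^ 2) * W w * ‖f w‖ ^ p))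
                z := by
            intro z
            by_cases hz : z ∈ disc
            swap
            · rw [oscKernel_eq_zero fun h => absurd h hz]
              positivity
            by_cases hzw : ‖w - z‖ < 4 * η ‖z‖
            swap
            · rw [oscKernel_eq_zero fun _ _ => not_lt.1 hzw]
              positivity
            have hηz := h.pos_norm hz
            have hzw' : ‖z - w‖ < 4 * η ‖z‖ := by rwa [norm_sub_rev]
            have habs := abs_le.1 (h.abs_scale_sub_le hz hw)
            rw [oscKernel_eq_mul hz hw hzw,
              indicator_of_mem (by rw [mem_ball_iff_norm]; linarith), hadef, ← ENNReal.ofReal_mul (by have := hW0 z hz; positivity)]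
            apply ENNReal.ofReal_le_ofReal
            have e1 : η ‖z‖ ^ p ≤ 2 ^ p * η ‖w‖ ^ p := by
              rw [← Real.mul_rpow (by norm_num) hηw.le]
              exact Real.rpow_le_rpow hηz.le (by linarith) hp.le
            have e2 : η ‖w‖ ^ 2 ≤ 4 * η ‖z‖ ^ 2 := by nlinarith
            have e3 : η ‖z‖ ^ p / η ‖z‖ ^ 2 ≤ 2 ^ p * 4 * (η ‖w‖ ^ p / η ‖w‖ ^ 2) := by
              rw [← mul_div_assoc, div_le_div_iff₀ (by positivity) (by positivity)]
              calc η ‖z‖ ^ p * η ‖w‖ ^ 2 ≤ (2 ^ p * η ‖w‖ ^ p) * (4 * η ‖z‖ ^ 2) :=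
                    mul_le_mul e1 e2 (by positivity) (by positivity)
                _ = _ := by ring
            have e4 := hWc z hz w hw hzw'.le
            calc 3 ^ p * η ‖z‖ ^ p / (Real.pi * η ‖z‖ ^ 2) * W z * ‖f w‖ ^ p
                = 3 ^ p / Real.pi * (η ‖z‖ ^ p / η ‖z‖ ^ 2) * W z * ‖f w‖ ^ p := by
                  field_simp
              _ ≤ 3 ^ p / Real.pi * (2 ^ p * 4 * (η ‖w‖ ^ p / η ‖w‖ ^ 2)) * (c * W w) *
                    ‖f w‖ ^ p := by
                  have := hW0 z hz
                  gcongr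
              _ = _ := by ring
          refine (lintegral_mono hpt).trans ?_
          rw [lintegral_indicator_const measurableSet_ball, Complex.volume_ball,
            ← ENNReal.ofReal_mul (by positivity)]
          have hpi : (NNReal.pi : ℝ≥0∞) = ENNReal.ofReal Real.pi := by
            rw [← NNReal.coe_real_pi, ENNReal.ofReal_coe_nnreal]
          rw [hpi, ← ENNReal.ofReal_pow (by positivity), ← ENNReal.ofReal_mul (by positivity),
            ← ENNReal.ofReal_mul (by positivity)]
          apply ENNReal.ofReal_le_ofReal
          refine le_of_eq ?_
          field_simp
          ring
        · simp [oscKernel_eq_zero (η := η) (p := p) (f := f) (a := a) fun _ h => absurd h hw]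
    _ = _ := by
        rw [lintegral_indicator measurableSet_disc, lintegral_const_mul' _ _ ENNReal.ofReal_ne_top]

/-! ### The Littlewood–Paley inequality -/

theorem norm_circleMap_zero_of_nonneg {r : ℝ} (hr : 0 ≤ r) (θ : ℝ) : ‖circleMap 0 r θ‖ = r := by
  simp [abs_of_nonneg hr]

theorem norm_circleMap_sub_circleMap (r s θ : ℝ) :
    ‖circleMap 0 r θ - circleMap 0 s θ‖ = |r - s| := by
  simp only [circleMap, zero_add, ← sub_mul, norm_mul, Complex.norm_exp_ofReal_mul_I, mul_one]
  rw [← Complex.ofReal_sub, Complex.norm_real, Real.norm_eq_abs]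

namespace IsRadialScale

theorem norm_sub_rpow_le_oscBound (h : IsRadialScale K Φ η) {p : ℝ} (hp : 0 < p) {F F' : ℂ → ℂ}
    (hF : ∀ w ∈ disc, HasDerivAt F (F' w) w) (hF' : AnalyticOnNhd ℂ F' disc) {z z' : ℂ}
    (hz : z ∈ disc) (hz' : ‖z' - z‖ ≤ 3 * η ‖z‖) :
    ENNReal.ofReal (‖F z - F z'‖ ^ p) ≤ oscBound η p F' z := by
  have hsub : Metric.ball z (4 * η ‖z‖) ⊆ disc :=
    (Metric.ball_subset_ball (by linarith [h.pos_norm hz])).trans (h.ball_subset_disc hz)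
  exact norm_sub_rpow_le_lintegral hp (h.pos_norm hz) (fun w hw => hF w (hsub hw))
    (hF'.mono hsub) hz'

theorem shift_pos (h : IsRadialScale K Φ η) {r : ℝ} (hr : r ∈ Ioo (2 * η 0) 1) :
    r / 2 ≤ r - η r ∧ 0 < r - η r ∧ r - η r < r ∧ 0 < r := by
  have h0 := h.pos 0 ⟨le_rfl, one_pos⟩
  have hr' : r ∈ Ico (0 : ℝ) 1 := ⟨by linarith [hr.1], hr.2⟩
  have h1 := h.anti ⟨le_rfl, one_pos⟩ hr' hr'.1
  have h2 := h.pos r hr'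
  exact ⟨by linarith [hr.1], by linarith [hr.1], by linarith, by linarith [hr.1]⟩

/-- Moving one step `η` towards the origin gains the small factor `e^{-pK/2}`. -/
theorem exp_exponent_shift (h : IsRadialScale K Φ η) (hK : 0 ≤ K) {p : ℝ} (hp : 0 < p) {r : ℝ}
    (hr : r ∈ Ioo (2 * η 0) 1) :
    Real.exp (-p * Φ r) ≤ Real.exp (-(p * K / 2)) * Real.exp (-p * Φ (r - η r)) := by
  rw [← Real.exp_add]
  apply Real.exp_le_exp.2
  obtain ⟨-, h1, h2, h3⟩ := h.shift_pos hr
  have hs := h.slope_ge _ _ h1.le h2.le hr.2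
  have hηs := h.pos (r - η r) ⟨h1.le, h2.trans hr.2⟩
  have hηr := h.pos r ⟨h3.le, hr.2⟩
  have hl := abs_le.1 (h.lip (r - η r) ⟨h1.le, h2.trans hr.2⟩ r ⟨h3.le, hr.2⟩)
  rw [show r - η r - r = -η r by ring, abs_neg, abs_of_pos hηr] at hl
  have hfrac : 1 / 2 ≤ (r - (r - η r)) / η (r - η r) := by
    rw [div_le_div_iff₀ (by norm_num) hηs]
    linarith [hl.2]
  have := mul_le_mul_of_nonneg_left hfrac hK
  nlinarith

theorem shift_strictMonoOn (h : IsRadialScale K Φ η) :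
    StrictMonoOn (fun r => r - η r) (Ico 0 1) := by
  intro r hr s hs hrs
  have := (abs_le.1 (h.lip s hs r hr)).2
  rw [abs_of_pos (sub_pos.2 hrs)] at this
  simp only
  linarith

theorem deriv_nonpos (h : IsRadialScale K Φ η) {r : ℝ} (hr : r ∈ Ioo (0 : ℝ) 1) :
    deriv η r ≤ 0 := by
  rw [← derivWithin_of_isOpen isOpen_Ioo hr]
  exact (h.anti.mono Ioo_subset_Ico_self).derivWithin_nonpos

end IsRadialScale

/-- The substitution `s = r - η r` does not increase integrals, as `s' = 1 - η' ≥ 1`. -/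
theorem lintegral_comp_shift_le (h : IsRadialScale K Φ η) {R : ℝ} (hR : R ≤ 1)
    (u : ℝ → ℝ≥0∞) :
    ∫⁻ r in Ioo (2 * η 0) R, u (r - η r) ≤ ∫⁻ r in Ioo 0 R, u r := by
  have hsub : ∀ r ∈ Ioo (2 * η 0) R, r ∈ Ioo (2 * η 0) 1 := fun r hr => ⟨hr.1, hr.2.trans_le hR⟩
  have h01 : ∀ r ∈ Ioo (2 * η 0) R, r ∈ Ioo (0 : ℝ) 1 := fun r hr =>
    ⟨(h.shift_pos (hsub r hr)).2.2.2, hr.2.trans_le hR⟩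
  have hcv := lintegral_image_eq_lintegral_deriv_mul_of_monotoneOn (f := fun r => r - η r)
    (f' := fun r => 1 - deriv η r) (s := Ioo (2 * η 0) R) measurableSet_Ioo
    (fun r hr => ((hasDerivAt_id r).sub (h.diff r (h01 r hr)).hasDerivAt).hasDerivWithinAt)
    (h.shift_strictMonoOn.monotoneOn.mono fun r hr => Ioo_subset_Ico_self (h01 r hr)) u
  calc ∫⁻ r in Ioo (2 * η 0) R, u (r - η r)
      ≤ ∫⁻ r in Ioo (2 * η 0) R, ENNReal.ofReal (1 - deriv η r) * u (r - η r) := by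
        refine setLIntegral_mono' measurableSet_Ioo fun r hr => ?_
        refine le_mul_of_one_le_left' ?_
        rw [ENNReal.one_le_ofReal]
        linarith [h.deriv_nonpos (h01 r hr)]
    _ = ∫⁻ r in (fun r => r - η r) '' Ioo (2 * η 0) R, u r := hcv.symm
    _ ≤ ∫⁻ r in Ioo 0 R, u r := by
        refine lintegral_mono_set ?_
        rintro _ ⟨r, hr, rfl⟩
        have := h.shift_pos (hsub r hr)
        exact ⟨this.2.1, this.2.2.1.trans hr.2⟩

/-- Pointwise form of the Hardy inequality: `|F|^p W` at `z` is at most half its value one step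
`η` closer to the origin (or nothing at all, near the origin), plus the oscillation term. -/
theorem norm_rpow_shift_le (h : IsRadialScale K Φ η) (hK : 0 ≤ K) {p : ℝ} (hp : 0 < p)
    (hKp : 8 * 2 ^ p ≤ Real.exp (p * K / 2)) {V : ℂ → ℝ} (hV : ∀ z ∈ disc, 0 < V z)
    (hVc : ∀ z ∈ disc, ∀ w ∈ disc, ‖z - w‖ ≤ 4 * η ‖z‖ → V z ≤ 2 * V w) {F F' : ℂ → ℂ}
    (hF : ∀ w ∈ disc, HasDerivAt F (F' w) w) (hF' : AnalyticOnNhd ℂ F' disc) {r θ : ℝ}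
    (hr : r ∈ Ioo (2 * η 0) 1) :
    ENNReal.ofReal r * ENNReal.ofReal
        (‖F (circleMap 0 r θ)‖ ^ p * (V (circleMap 0 r θ) * Real.exp (-p * Φ r))) ≤
      ENNReal.ofReal (1 / 2) * (ENNReal.ofReal (r - η r) * ENNReal.ofReal
        (‖F (circleMap 0 (r - η r) θ)‖ ^ p *
          (V (circleMap 0 (r - η r) θ) * Real.exp (-p * Φ (r - η r))))) +
      ENNReal.ofReal (2 ^ p) * (ENNReal.ofReal r * (oscBound η p F' (circleMap 0 r θ) *
        ENNReal.ofReal (V (circleMap 0 r θ) * Real.exp (-p * Φ r)))) := by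
  obtain ⟨hr2, hs0, hsr, hr0⟩ := h.shift_pos hr
  set s := r - η r with hs
  set z := circleMap 0 r θ with hz
  set z' := circleMap 0 s θ with hz'
  have hzn : ‖z‖ = r := norm_circleMap_zero_of_nonneg hr0.le θ
  have hzn' : ‖z'‖ = s := norm_circleMap_zero_of_nonneg hs0.le θ
  have hzd : z ∈ disc := by simpa [disc, hzn] using hr.2
  have hzd' : z' ∈ disc := by simpa [disc, hzn'] using hsr.trans hr.2
  have hηr := h.pos r ⟨hr0.le, hr.2⟩
  have hdist : ‖z - z'‖ = η r := by
    rw [hz, hz', norm_circleMap_sub_circleMap, hs, sub_sub_cancel, abs_of_pos hηr]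
  have hosc := h.norm_sub_rpow_le_oscBound hp hF hF' hzd (z' := z')
    (by rw [norm_sub_rev, hdist, hzn]; linarith)
  have hVz := hV z hzd
  have hVz' := hV z' hzd'
  have hVV := hVc z hzd z' hzd' (by rw [hdist, hzn]; linarith)
  have hexp := h.exp_exponent_shift hK hp hr
  have htri : ‖F z‖ ^ p ≤ 2 ^ p * (‖F z'‖ ^ p + ‖F z - F z'‖ ^ p) := by
    refine le_trans (Real.rpow_le_rpow (norm_nonneg _) ?_ hp.le)
      (add_rpow_le_two_rpow (norm_nonneg _) (norm_nonneg _) hp)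
    simpa using norm_add_le (F z') (F z - F z')
  have hmain : r * (‖F z‖ ^ p * (V z * Real.exp (-p * Φ r))) ≤
      1 / 2 * (s * (‖F z'‖ ^ p * (V z' * Real.exp (-p * Φ s)))) +
      2 ^ p * (r * (‖F z - F z'‖ ^ p * (V z * Real.exp (-p * Φ r)))) := by
    have hW : V z * Real.exp (-p * Φ r) ≤
        2 * V z' * (Real.exp (-(p * K / 2)) * Real.exp (-p * Φ s)) :=
      mul_le_mul hVV hexp (by positivity) (by positivity)
    have hKp' : 2 ^ p * Real.exp (-(p * K / 2)) ≤ 1 / 8 := by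
      rw [Real.exp_neg, ← div_eq_mul_inv, div_le_div_iff₀ (by positivity) (by norm_num)]
      linarith
    calc r * (‖F z‖ ^ p * (V z * Real.exp (-p * Φ r)))
        ≤ r * (2 ^ p * (‖F z'‖ ^ p + ‖F z - F z'‖ ^ p) * (V z * Real.exp (-p * Φ r))) := by gcongr
      _ = 2 ^ p * r * ‖F z'‖ ^ p * (V z * Real.exp (-p * Φ r)) +
          2 ^ p * (r * (‖F z - F z'‖ ^ p * (V z * Real.exp (-p * Φ r)))) := by ring
      _ ≤ 2 ^ p * (2 * s) * ‖F z'‖ ^ p *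
            (2 * V z' * (Real.exp (-(p * K / 2)) * Real.exp (-p * Φ s))) +
          2 ^ p * (r * (‖F z - F z'‖ ^ p * (V z * Real.exp (-p * Φ r)))) := by
          gcongr
          linarith
      _ = 4 * (2 ^ p * Real.exp (-(p * K / 2))) *
            (s * (‖F z'‖ ^ p * (V z' * Real.exp (-p * Φ s)))) +
          2 ^ p * (r * (‖F z - F z'‖ ^ p * (V z * Real.exp (-p * Φ r)))) := by ring
      _ ≤ 4 * (1 / 8) * (s * (‖F z'‖ ^ p * (V z' * Real.exp (-p * Φ s)))) +
          2 ^ p * (r * (‖F z - F z'‖ ^ p * (V z * Real.exp (-p * Φ r)))) := by gcongr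
      _ = _ := by ring
  calc _ = ENNReal.ofReal (r * (‖F z‖ ^ p * (V z * Real.exp (-p * Φ r)))) :=
        (ENNReal.ofReal_mul hr0.le).symm
    _ ≤ _ := ENNReal.ofReal_le_ofReal hmain
    _ = ENNReal.ofReal (1 / 2) * (ENNReal.ofReal s * ENNReal.ofReal
          (‖F z'‖ ^ p * (V z' * Real.exp (-p * Φ s)))) +
        ENNReal.ofReal (2 ^ p) * (ENNReal.ofReal r * (ENNReal.ofReal (‖F z - F z'‖ ^ p) *
          ENNReal.ofReal (V z * Real.exp (-p * Φ r)))) := by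
        rw [ENNReal.ofReal_add (by positivity) (by positivity), ENNReal.ofReal_mul (by positivity),
          ENNReal.ofReal_mul hs0.le, ENNReal.ofReal_mul (p := 2 ^ p) (by positivity),
          ENNReal.ofReal_mul hr0.le, ENNReal.ofReal_mul (p := ‖F z - F z'‖ ^ p) (by positivity)]
    _ ≤ _ := by gcongr

/-- The weighted Hardy inequality on a disc of radius `R < 1`. -/
theorem setLIntegral_ball_le_oscBound (h : IsRadialScale K Φ η) (hK : 0 ≤ K) {p : ℝ} (hp : 0 < p)
    (hKp : 8 * 2 ^ p ≤ Real.exp (p * K / 2)) {V : ℂ → ℝ} (hV : ∀ z ∈ disc, 0 < V z)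
    (hVcont : ContinuousOn V disc)
    (hVc : ∀ z ∈ disc, ∀ w ∈ disc, ‖z - w‖ ≤ 4 * η ‖z‖ → V z ≤ 2 * V w) {F F' : ℂ → ℂ}
    (hF : ∀ w ∈ disc, HasDerivAt F (F' w) w) (hF' : AnalyticOnNhd ℂ F' disc) (hF0 : F 0 = 0)
    {R : ℝ} (hR : R < 1) :
    ∫⁻ z in Metric.ball 0 R, ENNReal.ofReal (‖F z‖ ^ p * (V z * Real.exp (-p * Φ ‖z‖))) ≤
      ENNReal.ofReal (2 * 2 ^ p) * ∫⁻ z in disc, oscBound η p F' z *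
        ENNReal.ofReal (V z * Real.exp (-p * Φ ‖z‖)) := by
  have hWcont : ContinuousOn (fun z => V z * Real.exp (-p * Φ ‖z‖)) disc :=
    hVcont.mul (Real.continuous_exp.comp_continuousOn
      (continuousOn_const.mul h.continuousOn_exponent_norm))
  have hFcont : ContinuousOn F disc := fun w hw => (hF w hw).continuousAt.continuousWithinAt
  have hAcont : ContinuousOn (fun z => ‖F z‖ ^ p * (V z * Real.exp (-p * Φ ‖z‖))) disc :=
    (hFcont.norm.rpow_const fun _ _ => Or.inr hp.le).mul hWcont
  set A : ℂ → ℝ≥0∞ := disc.indicator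
    fun z => ENNReal.ofReal (‖F z‖ ^ p * (V z * Real.exp (-p * Φ ‖z‖))) with hA
  set E : ℂ → ℝ≥0∞ := disc.indicator
    fun z => oscBound η p F' z * ENNReal.ofReal (V z * Real.exp (-p * Φ ‖z‖)) with hE
  have hAm : Measurable A := measurable_indicator_of_continuousOn measurableSet_disc
    (ENNReal.continuous_ofReal.comp_continuousOn hAcont)
  have hEm : Measurable E := measurable_oscBound_mul h hp hF'.continuousOn hWcont
  have hball : Metric.ball (0 : ℂ) R ⊆ disc := Metric.ball_subset_ball hR.le
  have hmem : ∀ r ∈ Ioo (0 : ℝ) 1, ∀ θ, circleMap 0 r θ ∈ disc := fun r hr θ => by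
    simpa [disc, abs_of_pos hr.1] using hr.2
  have h0 : (0 : ℝ) ∈ Ico (0 : ℝ) 1 := ⟨le_rfl, one_pos⟩
  have hpt : ∀ θ : ℝ, ∀ r ∈ Ioo 0 R, ENNReal.ofReal r * A (circleMap 0 r θ) ≤
      (Ioo (2 * η 0) R).indicator (fun r => ENNReal.ofReal (1 / 2) *
        (ENNReal.ofReal (r - η r) * A (circleMap 0 (r - η r) θ))) r +
      ENNReal.ofReal (2 ^ p) * (ENNReal.ofReal r * E (circleMap 0 r θ)) := by
    intro θ r hr
    have hr1 : r ∈ Ioo (0 : ℝ) 1 := ⟨hr.1, hr.2.trans hR⟩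
    have hd := hmem r hr1 θ
    have hn := norm_circleMap_zero_of_nonneg hr.1.le θ
    -- close to the origin, step to `0` itself, where `F` vanishes
    by_cases hlt : 2 * η 0 < r
    · have hr2 : r ∈ Ioo (2 * η 0) 1 := ⟨hlt, hr1.2⟩
      obtain ⟨-, hs0, hsr, -⟩ := h.shift_pos hr2
      rw [indicator_of_mem (show r ∈ Ioo (2 * η 0) R from ⟨hlt, hr.2⟩), hA, hE,
        indicator_of_mem hd, indicator_of_mem hd, indicator_of_mem
        (hmem (r - η r) ⟨hs0, hsr.trans hr1.2⟩ θ), hn, norm_circleMap_zero_of_nonneg hs0.le]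
      exact norm_rpow_shift_le h hK hp hKp hV hVc hF hF' hr2
    · rw [indicator_of_notMem (fun hh => hlt hh.1), zero_add, hA, hE, indicator_of_mem hd,
        indicator_of_mem hd]
      have hηr := h.pos r ⟨hr.1.le, hr1.2⟩
      have hlip := (abs_le.1 (h.lip 0 h0 r ⟨hr.1.le, hr1.2⟩)).2
      rw [zero_sub, abs_neg, abs_of_pos hr.1] at hlip
      have hosc := h.norm_sub_rpow_le_oscBound hp hF hF' hd (z' := 0)
        (by rw [zero_sub, norm_neg, hn]; linarith)
      rw [hF0, sub_zero] at hosc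
      rw [ENNReal.ofReal_mul (by positivity)]
      refine le_mul_of_one_le_of_le ?_ (by gcongr)
      rw [ENNReal.one_le_ofReal]
      exact Real.one_le_rpow (by norm_num) hp.le
  have hmain : ∫⁻ z in Metric.ball 0 R, A z ≤ ENNReal.ofReal (1 / 2) *
      (∫⁻ z in Metric.ball 0 R, A z) + ENNReal.ofReal (2 ^ p) * ∫⁻ z in disc, E z := by
    calc ∫⁻ z in Metric.ball 0 R, A z
        = ∫⁻ θ in Ioo (-Real.pi) Real.pi, ∫⁻ r in Ioo 0 R,
            ENNReal.ofReal r * A (circleMap 0 r θ) := lintegral_ball_eq_lintegral_angle 0 R hAm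
      _ ≤ ∫⁻ θ in Ioo (-Real.pi) Real.pi, (ENNReal.ofReal (1 / 2) *
            (∫⁻ r in Ioo 0 R, ENNReal.ofReal r * A (circleMap 0 r θ)) +
            ENNReal.ofReal (2 ^ p) * ∫⁻ r in Ioo 0 R, ENNReal.ofReal r * E (circleMap 0 r θ)) := by
          refine lintegral_mono fun θ => ?_
          refine (setLIntegral_mono' measurableSet_Ioo (hpt θ)).trans ?_
          have hm : Measurable fun r => ENNReal.ofReal (2 ^ p) *
              (ENNReal.ofReal r * E (circleMap 0 r θ)) :=
            ((measurable_polar_integrand 0 hEm).comp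
              (measurable_id.prodMk measurable_const)).const_mul _
          rw [lintegral_add_right _ hm]
          gcongr
          · rw [setLIntegral_indicator measurableSet_Ioo]
            refine (lintegral_mono_set inter_subset_left).trans ?_
            rw [lintegral_const_mul' _ _ ENNReal.ofReal_ne_top]
            exact mul_le_mul' le_rfl (lintegral_comp_shift_le h hR.le
              fun s => ENNReal.ofReal s * A (circleMap 0 s θ))
          · rw [lintegral_const_mul' _ _ ENNReal.ofReal_ne_top]
      _ = ENNReal.ofReal (1 / 2) * (∫⁻ z in Metric.ball 0 R, A z) +
            ENNReal.ofReal (2 ^ p) * ∫⁻ z in Metric.ball 0 R, E z := by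
          rw [lintegral_add_left, lintegral_const_mul' _ _ ENNReal.ofReal_ne_top,
            lintegral_const_mul' _ _ ENNReal.ofReal_ne_top,
            ← lintegral_ball_eq_lintegral_angle 0 R hAm,
            ← lintegral_ball_eq_lintegral_angle 0 R hEm]
          exact Measurable.const_mul (Measurable.lintegral_prod_right'
            (f := fun q : ℝ × ℝ => ENNReal.ofReal q.2 * A (circleMap 0 q.2 q.1))
            ((measurable_polar_integrand 0 hAm).comp measurable_swap)) _
      _ ≤ _ := by
          gcongr
  -- finiteness on the smaller disc permits absorbing the first term
  have hfin : ∫⁻ z in Metric.ball 0 R, A z ≠ ⊤ := by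
    have hint : IntegrableOn (fun z => ‖F z‖ ^ p * (V z * Real.exp (-p * Φ ‖z‖)))
        (Metric.closedBall 0 R) :=
      (hAcont.mono (Metric.closedBall_subset_ball hR)).integrableOn_compact
        (isCompact_closedBall 0 R)
    refine (lt_of_le_of_lt ?_ hint.lintegral_lt_top).ne
    refine (lintegral_mono_set Metric.ball_subset_closedBall).trans
      (lintegral_mono fun z => indicator_le_self _ _ z)
  have hAeq : ∫⁻ z in Metric.ball 0 R,
      ENNReal.ofReal (‖F z‖ ^ p * (V z * Real.exp (-p * Φ ‖z‖))) = ∫⁻ z in Metric.ball 0 R, A z :=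
    setLIntegral_congr_fun measurableSet_ball fun z hz => by
      rw [hA, indicator_of_mem (hball hz)]
  have hEeq : ∫⁻ z in disc, oscBound η p F' z * ENNReal.ofReal (V z * Real.exp (-p * Φ ‖z‖))
      = ∫⁻ z in disc, E z :=
    setLIntegral_congr_fun measurableSet_disc fun z hz => by
      rw [hE, indicator_of_mem hz]
  rw [hAeq, hEeq]
  set X := ∫⁻ z in Metric.ball 0 R, A z
  set Y := ∫⁻ z in disc, E z
  rcases eq_or_ne Y ⊤ with hY | hY
  · rw [hY, ENNReal.mul_top (by simp; positivity)]
    exact le_top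
  have hr := ENNReal.toReal_mono (by finiteness) hmain
  rw [ENNReal.toReal_add (by finiteness) (by finiteness), ENNReal.toReal_mul, ENNReal.toReal_mul,
    ENNReal.toReal_ofReal (by norm_num), ENNReal.toReal_ofReal (by positivity)] at hr
  rw [← ENNReal.ofReal_toReal hfin, ← ENNReal.ofReal_toReal hY,
    ← ENNReal.ofReal_mul (by positivity)]
  exact ENNReal.ofReal_le_ofReal (by linarith)

/-- A one-sided Littlewood–Paley inequality with constants that do not depend on the slowly varying
factor `V` of the weight. -/
theorem lintegral_norm_rpow_le_deriv (h : IsRadialScale K Φ η) (hK : 0 ≤ K) {p : ℝ} (hp : 0 < p)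
    (hKp : 8 * 2 ^ p ≤ Real.exp (p * K / 2)) {V : ℂ → ℝ} (hV : ∀ z ∈ disc, 0 < V z)
    (hVcont : ContinuousOn V disc)
    (hVc : ∀ z ∈ disc, ∀ w ∈ disc, ‖z - w‖ ≤ 4 * η ‖z‖ → V z ≤ 2 * V w) {F F' : ℂ → ℂ}
    (hF : ∀ w ∈ disc, HasDerivAt F (F' w) w) (hF' : AnalyticOnNhd ℂ F' disc) (hF0 : F 0 = 0) :
    ∫⁻ z in disc, ENNReal.ofReal (‖F z‖ ^ p * (V z * Real.exp (-p * Φ ‖z‖))) ≤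
      ENNReal.ofReal (2 * 2 ^ p * (3 ^ p * 2 ^ p * 144 * (2 * Real.exp (6 * p * K)))) *
        ∫⁻ z in disc, ENNReal.ofReal
          (‖F' z‖ ^ p * η ‖z‖ ^ p * (V z * Real.exp (-p * Φ ‖z‖))) := by
  have hdisc : disc = ⋃ n : ℕ, Metric.ball (0 : ℂ) (1 - 1 / ((n : ℝ) + 1)) := by
    ext z
    simp only [disc, mem_iUnion, mem_ball_zero_iff]
    constructor
    · intro hz
      obtain ⟨n, hn⟩ := exists_nat_one_div_lt (sub_pos.2 hz)
      exact ⟨n, by linarith⟩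
    · rintro ⟨n, hn⟩
      have : 0 < 1 / ((n : ℝ) + 1) := by positivity
      linarith
  have hW : ContinuousOn (fun z => V z * Real.exp (-p * Φ ‖z‖)) disc :=
    hVcont.mul (Real.continuous_exp.comp_continuousOn
      (continuousOn_const.mul h.continuousOn_exponent_norm))
  have hmono : Monotone fun n : ℕ => Metric.ball (0 : ℂ) (1 - 1 / ((n : ℝ) + 1)) := by
    intro m n hmn
    apply Metric.ball_subset_ball
    have : (m : ℝ) ≤ n := by exact_mod_cast hmn
    gcongr
  have hosc := lintegral_oscBound_mul_le h hp (c := 2 * Real.exp (6 * p * K)) (by positivity)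
    hF'.continuousOn hW (fun z hz => by have := hV z hz; positivity) fun z hz w hw hzw => by
      have h1 := hV w hw
      calc V z * Real.exp (-p * Φ ‖z‖)
          ≤ (2 * V w) * (Real.exp (6 * p * K) * Real.exp (-p * Φ ‖w‖)) :=
            mul_le_mul (hVc z hz w hw hzw) (h.exp_exponent_le hK hp hz hw hzw) (by positivity)
              (by positivity)
        _ = _ := by ring
  rw [hdisc, setLIntegral_iUnion_of_directed _ hmono.directed_le, ← hdisc]
  refine iSup_le fun n => ?_
  refine (setLIntegral_ball_le_oscBound h hK hp hKp hV hVcont hVc hF hF' hF0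
    (by have : 0 < 1 / ((n : ℝ) + 1) := by positivity
        linarith)).trans ?_
  rw [ENNReal.ofReal_mul (p := 2 * 2 ^ p) (by positivity), mul_assoc]
  gcongr

/-! ### Construction of the length scale -/

/-- Only monotonicity on `[0, 1)` is assumed, also for the two-sided derivative at `0`. -/
theorem deriv_nonneg_of_monotoneOn_Ico {u : ℝ → ℝ} (hu : MonotoneOn u (Ico 0 1)) {r : ℝ}
    (hr : r ∈ Ico (0 : ℝ) 1) (hd : DifferentiableAt ℝ u r) : 0 ≤ deriv u r := by
  rw [← hd.derivWithin (uniqueDiffOn_Ico 0 1 r hr)]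
  exact hu.derivWithin_nonneg

variable {φ : ℂ → ℝ}

namespace IsSmoothRapidlyDecreasing

theorem contDiffOn_profile (hφ : IsSmoothRapidlyDecreasing φ) :
    ContDiffOn ℝ 2 (fun r : ℝ => φ (r : ℂ)) (Ioo (-1) 1) := by
  refine hφ.contDiff.comp Complex.ofRealCLM.contDiff.contDiffOn fun r hr => ?_
  simpa [disc, abs_lt] using hr

theorem contDiffOn_radialDeriv (hφ : IsSmoothRapidlyDecreasing φ) :
    ContDiffOn ℝ 1 (radialDeriv φ) (Ioo (-1) 1) :=
  hφ.contDiffOn_profile.deriv_of_isOpen isOpen_Ioo (by norm_num)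

theorem hasDerivAt_profile (hφ : IsSmoothRapidlyDecreasing φ) {r : ℝ} (hr : r ∈ Ioo (-1 : ℝ) 1) :
    HasDerivAt (fun r : ℝ => φ (r : ℂ)) (radialDeriv φ r) r :=
  ((hφ.contDiffOn_profile.contDiffAt (isOpen_Ioo.mem_nhds hr)).differentiableAt
    (by norm_num)).hasDerivAt

theorem hasDerivAt_radialDeriv (hφ : IsSmoothRapidlyDecreasing φ) {r : ℝ}
    (hr : r ∈ Ioo (-1 : ℝ) 1) :
    HasDerivAt (radialDeriv φ) (deriv (radialDeriv φ) r) r :=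
  ((hφ.contDiffOn_radialDeriv.contDiffAt (isOpen_Ioo.mem_nhds hr)).differentiableAt
    (by norm_num)).hasDerivAt

theorem eq_profile_norm (hφ : IsSmoothRapidlyDecreasing φ) {z : ℂ} (hz : z ∈ disc) :
    φ z = φ (‖z‖ : ℂ) :=
  hφ.radial z hz _ (by simpa [disc] using hz) (by simp)

theorem Ico_zero_one_subset : Ico (0 : ℝ) 1 ⊆ Ioo (-1) 1 := fun r hr => ⟨by linarith [hr.1], hr.2⟩

theorem monotoneOn_radialDeriv (hφ : IsSmoothRapidlyDecreasing φ) :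
    MonotoneOn (radialDeriv φ) (Ico 0 1) :=
  hφ.convex.monotoneOn_deriv fun _ hr =>
    (hφ.hasDerivAt_profile (Ico_zero_one_subset hr)).differentiableAt

theorem radialDeriv_nonneg (hφ : IsSmoothRapidlyDecreasing φ) {r : ℝ} (hr : r ∈ Ico (0 : ℝ) 1) :
    0 ≤ radialDeriv φ r :=
  deriv_nonneg_of_monotoneOn_Ico hφ.monotone hr
    (hφ.hasDerivAt_profile (Ico_zero_one_subset hr)).differentiableAt

theorem deriv_radialDeriv_nonneg (hφ : IsSmoothRapidlyDecreasing φ) {r : ℝ}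
    (hr : r ∈ Ico (0 : ℝ) 1) : 0 ≤ deriv (radialDeriv φ) r :=
  deriv_nonneg_of_monotoneOn_Ico hφ.monotoneOn_radialDeriv hr
    (hφ.hasDerivAt_radialDeriv (Ico_zero_one_subset hr)).differentiableAt

/-- The Laplacian of a radial function in polar coordinates. -/
theorem laplacian_eq (hφ : IsSmoothRapidlyDecreasing φ) {r : ℝ} (hr : r ∈ Ioo (0 : ℝ) 1) :
    Laplacian.laplacian φ (r : ℂ) = deriv (radialDeriv φ) r + radialDeriv φ r / r := by
  have hrd : (r : ℂ) ∈ disc := by simpa [disc, abs_of_pos hr.1] using hr.2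
  have hφ2 : ∀ z ∈ disc, ContDiffAt ℝ 2 φ z := fun z hz =>
    hφ.contDiff.contDiffAt (isOpen_disc.mem_nhds hz)
  have hφ1 : ∀ z ∈ disc, HasFDerivAt φ (fderiv ℝ φ z) z := fun z hz =>
    ((hφ2 z hz).differentiableAt (by norm_num)).hasFDerivAt
  have hφ' : HasFDerivAt (fderiv ℝ φ) (fderiv ℝ (fderiv ℝ φ) r) (r : ℂ) :=
    (((hφ2 r hrd).fderiv_right (m := 1) (by norm_num)).differentiableAt (by norm_num)).hasFDerivAt
  have hline : ∀ (v : ℂ) (t : ℝ), HasDerivAt (fun t : ℝ => (r : ℂ) + t * v) v t := fun v t => by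
    simpa using ((Complex.ofRealCLM.hasDerivAt (x := t)).mul_const v).const_add (r : ℂ)
  have hdisc : ∀ v : ℂ, ∀ᶠ t : ℝ in 𝓝 0, (r : ℂ) + t * v ∈ disc := fun v =>
    (hline v 0).continuousAt.eventually_mem (by simpa using isOpen_disc.mem_nhds hrd)
  have h1 : ∀ v : ℂ, HasDerivAt (fun t : ℝ => fderiv ℝ φ ((r : ℂ) + t * v) v)
      (fderiv ℝ (fderiv ℝ φ) r v v) 0 := fun v => by
    have h2 : HasFDerivAt (fderiv ℝ φ) (fderiv ℝ (fderiv ℝ φ) r) ((r : ℂ) + (0 : ℝ) * v) := by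
      simpa using hφ'
    have h3 := h2.comp_hasDerivAt (0 : ℝ) (hline v 0)
    exact h3.clm_apply (hasDerivAt_const _ _) |>.congr_deriv (by simp)
  -- along the real axis `φ` is its profile
  have hx : fderiv ℝ (fderiv ℝ φ) r 1 1 = deriv (radialDeriv φ) r := by
    refine (h1 1).unique ?_
    have h4 := (hφ.hasDerivAt_radialDeriv ⟨by linarith [hr.1], hr.2⟩)
    have h5 : HasDerivAt (fun t : ℝ => radialDeriv φ (r + t)) (deriv (radialDeriv φ) r) 0 := by
      refine HasDerivAt.comp_const_add r 0 ?_
      rwa [add_zero]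
    refine h5.congr_of_eventuallyEq ?_
    filter_upwards [hdisc 1] with t ht
    have h6 := (hφ1 _ ht).comp_hasDerivAt t (hline 1 t)
    have h7 : HasDerivAt (fun s : ℝ => φ ((r + s : ℝ) : ℂ)) (radialDeriv φ (r + t)) t := by
      refine HasDerivAt.comp_const_add r t (hφ.hasDerivAt_profile ?_)
      have : ((r + t : ℝ) : ℂ) ∈ disc := by simpa using ht
      simp only [disc, mem_ball_zero_iff, Complex.norm_real, Real.norm_eq_abs, abs_lt] at this
      exact this
    refine h6.unique (h7.congr_of_eventuallyEq (Eventually.of_forall fun s => ?_))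
    simp
  -- along the vertical line through `r`, `φ (r + i t)` is the profile at `√(r² + t²)`
  have hy : fderiv ℝ (fderiv ℝ φ) r Complex.I Complex.I = radialDeriv φ r / r := by
    refine (h1 Complex.I).unique ?_
    have hs : HasDerivAt (fun t : ℝ => √(r ^ 2 + t ^ 2)) 0 0 := by
      have h2 : HasDerivAt (fun t : ℝ => r ^ 2 + t ^ 2) 0 0 := by
        simpa using ((hasDerivAt_id (0 : ℝ)).pow 2).const_add (r ^ 2)
      simpa using h2.sqrt (by have := hr.1; positivity)
    have hs0 : √(r ^ 2 + (0 : ℝ) ^ 2) = r := by simp [Real.sqrt_sq hr.1.le]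
    have hm : DifferentiableAt ℝ
        (fun t : ℝ => radialDeriv φ √(r ^ 2 + t ^ 2) / √(r ^ 2 + t ^ 2)) 0 := by
      refine DifferentiableAt.fun_div ?_ hs.differentiableAt (by rw [hs0]; exact hr.1.ne')
      refine DifferentiableAt.comp (g := radialDeriv φ) (0 : ℝ) ?_ hs.differentiableAt
      rw [hs0]
      exact (hφ.hasDerivAt_radialDeriv ⟨by linarith [hr.1], hr.2⟩).differentiableAt
    have h5 := (hasDerivAt_id (0 : ℝ)).mul hm.hasDerivAt
    simp only [id, one_mul, zero_mul, add_zero, hs0] at h5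
    refine h5.congr_of_eventuallyEq ?_
    filter_upwards [hdisc Complex.I] with t ht
    have h6 := (hφ1 _ ht).comp_hasDerivAt t (hline Complex.I t)
    refine h6.unique ?_
    have hnorm : ∀ s : ℝ, ‖(r : ℂ) + s * Complex.I‖ = √(r ^ 2 + s ^ 2) := fun s =>
      Complex.norm_add_mul_I r s
    have hpos : 0 < r ^ 2 + t ^ 2 := by have := hr.1; positivity
    have hlt : √(r ^ 2 + t ^ 2) < 1 := by
      rw [← hnorm]
      simpa [disc] using ht
    have h2 : HasDerivAt (fun t : ℝ => r ^ 2 + t ^ 2) (2 * t) t := by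
      simpa using ((hasDerivAt_id t).pow 2).const_add (r ^ 2)
    have h7 := (hφ.hasDerivAt_profile ⟨by linarith [Real.sqrt_nonneg (r ^ 2 + t ^ 2)],
      hlt⟩).comp t (h2.sqrt hpos.ne')
    refine HasDerivAt.congr_of_eventuallyEq (h7.congr_deriv ?_) ?_
    · simp only [id, Pi.mul_apply]
      field_simp
    · have hev : ∀ᶠ s : ℝ in 𝓝 t, (r : ℂ) + s * Complex.I ∈ disc :=
        (hline Complex.I t).continuousAt.eventually_mem (isOpen_disc.mem_nhds ht)
      filter_upwards [hev] with s hs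
      simp only [Function.comp]
      rw [hφ.eq_profile_norm hs, hnorm]
  rw [congrFun (InnerProductSpace.laplacian_eq_iteratedFDeriv_complexPlane φ) (r : ℂ),
    iteratedFDeriv_two_apply, iteratedFDeriv_two_apply]
  simpa using congrArg₂ (· + ·) hx hy

/-- The condition `τ' → 0` makes `1/τ`, hence the square root of the Laplacian, negligible
compared with `φ'` near the boundary. -/
theorem exists_laplacian_le_and_inv_le (hφ : IsSmoothRapidlyDecreasing φ) :
    ∃ τ : ℝ → ℝ, ∃ a : ℝ, 0 < a ∧ Tendsto τ (𝓝[<] 1) (𝓝[>] 0) ∧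
      (∀ r ∈ Ioo (0 : ℝ) 1, Laplacian.laplacian φ (r : ℂ) ≤ (a * (1 / τ r)) ^ 2) ∧
      ∀ ε > 0, ∀ᶠ r in 𝓝[<] (1 : ℝ), 1 / τ r ≤ ε * radialDeriv φ r := by
  obtain ⟨τ, hpos, -, hC1, hlim, hlim', ⟨a, b, ha, hb, hab⟩, -, -⟩ := hφ.exists_tau
  have hIoo : ∀ᶠ r in 𝓝[<] (1 : ℝ), r ∈ Ioo (1 / 2 : ℝ) 1 := Ioo_mem_nhdsLT (by norm_num)
  have hlap : ∀ r ∈ Ioo (0 : ℝ) 1, Laplacian.laplacian φ (r : ℂ) ≤ (1 / a * (1 / τ r)) ^ 2 ∧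
      1 / (b * τ r) ^ 2 ≤ Laplacian.laplacian φ (r : ℂ) := by
    intro r hr
    have hrd : (r : ℂ) ∈ disc := by simpa [disc, abs_of_pos hr.1] using hr.2
    have hL := hφ.laplacian_pos _ hrd
    have hτ := hpos r ⟨hr.1.le, hr.2⟩
    have h := hab _ hrd
    rw [Complex.norm_real, Real.norm_eq_abs, abs_of_pos hr.1, Real.rpow_neg hL.le,
      ← Real.sqrt_eq_rpow, ← one_div] at h
    have hs := Real.sqrt_pos.2 hL
    have hsq := Real.sq_sqrt hL.le
    constructor
    · rw [← hsq]
      have h1 : √(Laplacian.laplacian φ (r : ℂ)) ≤ 1 / (a * τ r) := by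
        rw [le_div_iff₀ (by positivity), mul_comm, ← le_div_iff₀ hs]
        exact h.1
      have h2 : 1 / a * (1 / τ r) = 1 / (a * τ r) := by field_simp
      rw [h2]
      gcongr
    · rw [← hsq]
      have h1 : 1 / (b * τ r) ≤ √(Laplacian.laplacian φ (r : ℂ)) := by
        rw [div_le_iff₀ (by positivity), mul_comm, ← div_le_iff₀ hs]
        exact h.2
      have h2 : 1 / (b * τ r) ^ 2 = (1 / (b * τ r)) ^ 2 := by field_simp
      rw [h2]
      gcongr
  have hlim0 : Tendsto τ (𝓝[<] 1) (𝓝[>] 0) := by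
    refine tendsto_nhdsWithin_iff.2 ⟨hlim, ?_⟩
    filter_upwards [hIoo] with r hr
    exact hpos r ⟨by linarith [hr.1], hr.2⟩
  refine ⟨τ, 1 / a, by positivity, hlim0, fun r hr => (hlap r hr).1, fun ε hε => ?_⟩
  -- `2δb² rφ' - 1/τ` is increasing once `-τ' ≤ δ`
  set δ := ε / (4 * b ^ 2) with hδ
  have hδpos : 0 < δ := by positivity
  have hev : ∀ᶠ r in 𝓝[<] (1 : ℝ), -δ < deriv τ r := hlim'.eventually (lt_mem_nhds (by linarith))
  obtain ⟨r₁, hr₁, hsub⟩ := (mem_nhdsLT_iff_exists_Ioo_subset' (zero_lt_one' ℝ)).1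
    (hev.and hIoo)
  set m := max (1 / 2) r₁ with hm
  have hm1 : m < 1 := max_lt (by norm_num) hr₁
  set r₂ := (m + 1) / 2 with hr₂
  have hmr : m < r₂ := by linarith
  have hr21 : r₂ < 1 := by linarith
  have hhalf : 1 / 2 ≤ m := le_max_left _ _
  have hr₁m : r₁ ≤ m := le_max_right _ _
  have hτd : ∀ r ∈ Ioo (0 : ℝ) 1, HasDerivAt τ (deriv τ r) r := fun r hr =>
    ((hC1.contDiffAt (Ico_mem_nhds hr.1 hr.2)).differentiableAt (by norm_num)).hasDerivAt
  have hqd : ∀ r ∈ Ico r₂ 1, HasDerivAt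
      (fun r => 2 * δ * b ^ 2 * (r * radialDeriv φ r) - (τ r)⁻¹)
      (2 * δ * b ^ 2 * (1 * radialDeriv φ r + r * deriv (radialDeriv φ) r) -
        -deriv τ r / τ r ^ 2) r := by
    intro r hr
    have hr0 : r ∈ Ioo (0 : ℝ) 1 := ⟨by linarith [hr.1], hr.2⟩
    exact (((hasDerivAt_id r).mul (hφ.hasDerivAt_radialDeriv
      (Ico_zero_one_subset ⟨hr0.1.le, hr0.2⟩))).const_mul _).sub
      ((hτd r hr0).fun_inv (hpos r ⟨hr0.1.le, hr0.2⟩).ne')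
  have hmono : MonotoneOn (fun r => 2 * δ * b ^ 2 * (r * radialDeriv φ r) - (τ r)⁻¹)
      (Ico r₂ 1) := by
    refine monotoneOn_of_deriv_nonneg (convex_Ico _ _)
      (fun r hr => (hqd r hr).continuousAt.continuousWithinAt)
      (fun r hr => (hqd r (interior_subset hr)).differentiableAt.differentiableWithinAt)
      fun r hr => ?_
    have hr' := interior_subset hr
    have hr0 : r ∈ Ioo (0 : ℝ) 1 := ⟨by linarith [hr'.1], hr'.2⟩
    have hτ := hpos r ⟨hr0.1.le, hr0.2⟩
    have hd : -δ < deriv τ r := (hsub ⟨by linarith [hr'.1], hr'.2⟩).1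
    rw [(hqd r hr').deriv]
    have h1 : 1 * radialDeriv φ r + r * deriv (radialDeriv φ) r
        = r * Laplacian.laplacian φ (r : ℂ) := by
      rw [hφ.laplacian_eq hr0]
      have := hr0.1.ne'
      field_simp
      ring
    have h2 := (hlap r hr0).2
    have h3 : 1 / 2 * (1 / (b * τ r) ^ 2) ≤ r * Laplacian.laplacian φ (r : ℂ) :=
      mul_le_mul (by linarith [hr'.1]) h2 (by positivity) hr0.1.le
    have h4 : 2 * δ * b ^ 2 * (1 / 2 * (1 / (b * τ r) ^ 2)) = δ / τ r ^ 2 := by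
      field_simp
    have h5 : -deriv τ r / τ r ^ 2 ≤ δ / τ r ^ 2 := by gcongr; linarith
    have h6 := mul_le_mul_of_nonneg_left h3 (show 0 ≤ 2 * δ * b ^ 2 by positivity)
    rw [h1]
    linarith
  have hinv : Tendsto (fun r => (τ r)⁻¹) (𝓝[<] 1) atTop := tendsto_inv_nhdsGT_zero.comp hlim0
  filter_upwards [hinv.eventually_ge_atTop (2 * (τ r₂)⁻¹), Ioo_mem_nhdsLT hr21] with r hr hr2
  have h1 := hmono ⟨le_rfl, hr21⟩ ⟨hr2.1.le, hr2.2⟩ hr2.1.le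
  have h2 := hφ.radialDeriv_nonneg (r := r₂) ⟨by linarith, hr21⟩
  have h3 := hφ.radialDeriv_nonneg (r := r) ⟨by linarith [hr2.1], hr2.2⟩
  simp only at h1
  have h4 : 0 ≤ 2 * δ * b ^ 2 * (r₂ * radialDeriv φ r₂) := by
    have : 0 < r₂ := by linarith
    positivity
  have h5 : 2 * δ * b ^ 2 * (r * radialDeriv φ r) ≤ 2 * δ * b ^ 2 * (1 * radialDeriv φ r) := by
    have := hr2.2.le
    gcongr
  have h6 : 2 * δ * b ^ 2 = ε / 2 := by rw [hδ]; field_simp; norm_num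
  rw [h6] at h1 h4 h5
  rw [one_div]
  linarith

theorem tendsto_radialDeriv (hφ : IsSmoothRapidlyDecreasing φ) :
    Tendsto (radialDeriv φ) (𝓝[<] 1) atTop := by
  obtain ⟨τ, a, ha, hlim, -, h⟩ := hφ.exists_laplacian_le_and_inv_le
  refine tendsto_atTop_mono' _ ?_ (tendsto_inv_nhdsGT_zero.comp hlim)
  filter_upwards [h 1 one_pos] with r hr
  simpa using hr

theorem eventually_deriv_radialDeriv_le (hφ : IsSmoothRapidlyDecreasing φ) {ε : ℝ} (hε : 0 < ε) :
    ∀ᶠ r in 𝓝[<] (1 : ℝ), deriv (radialDeriv φ) r ≤ ε * radialDeriv φ r ^ 2 := by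
  obtain ⟨τ, a, ha, hlim, hlap, h⟩ := hφ.exists_laplacian_le_and_inv_le
  have hpos := hlim.eventually self_mem_nhdsWithin
  filter_upwards [h (√ε / a) (by positivity), Ioo_mem_nhdsLT (zero_lt_one' ℝ), hpos]
    with r hr hr1 hτ
  have hτ : 0 < τ r := hτ
  have h1 := hlap r hr1
  rw [hφ.laplacian_eq hr1] at h1
  have h2 : 0 ≤ radialDeriv φ r / r := div_nonneg (hφ.radialDeriv_nonneg ⟨hr1.1.le, hr1.2⟩) hr1.1.le
  have h3 : a * (1 / τ r) ≤ √ε * radialDeriv φ r := by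
    calc a * (1 / τ r) ≤ a * (√ε / a * radialDeriv φ r) := by gcongr
      _ = _ := by field_simp
  have h4 : (a * (1 / τ r)) ^ 2 ≤ (√ε * radialDeriv φ r) ^ 2 := by gcongr
  rw [mul_pow √ε, Real.sq_sqrt hε.le] at h4
  linarith

/-- For `N` large, `K / (N + φ')` is a length scale for the weight exponent `φ + N r`. -/
theorem exists_isRadialScale (hφ : IsSmoothRapidlyDecreasing φ) {K : ℝ} (hK : 0 < K) :
    ∃ N : ℝ, 1 ≤ N ∧ IsRadialScale K (fun r => φ (r : ℂ) + N * r)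
      (fun r => K / (N + radialDeriv φ r)) := by
  obtain ⟨r₁, hr₁, hsub⟩ := (mem_nhdsLT_iff_exists_Ioo_subset' (zero_lt_one' ℝ)).1
    (hφ.eventually_deriv_radialDeriv_le (ε := 1 / (16 * K)) (by positivity))
  have hcont : ContinuousOn (deriv (radialDeriv φ)) (Icc 0 r₁) := by
    have h := (hφ.contDiffOn_radialDeriv.deriv_of_isOpen (m := 0) isOpen_Ioo
      (by norm_num)).continuousOn
    exact h.mono fun r hr => ⟨by linarith [hr.1], hr.2.trans_lt hr₁⟩
  obtain ⟨S, hS⟩ := isCompact_Icc.exists_bound_of_continuousOn hcont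
  -- away from the boundary `φ'' ≤ S`, and `N` takes over the role of `φ'`
  set N := max 1 (16 * K * S) with hN
  have hN1 : 1 ≤ N := le_max_left _ _
  have hNS : 16 * K * S ≤ N := le_max_right _ _
  have hD : ∀ r ∈ Ico (0 : ℝ) 1, 0 < N + radialDeriv φ r := fun r hr => by
    linarith [hφ.radialDeriv_nonneg hr]
  have hbound : ∀ r ∈ Ico (0 : ℝ) 1,
      K * deriv (radialDeriv φ) r ≤ 1 / 16 * (N + radialDeriv φ r) ^ 2 := by
    intro r hr
    have h0 := hφ.radialDeriv_nonneg hr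
    rcases le_or_gt r r₁ with hle | hgt
    · have h1 := (le_abs_self _).trans (hS r ⟨hr.1, hle⟩)
      have h2 : N ≤ (N + radialDeriv φ r) ^ 2 := by nlinarith
      have h3 := mul_le_mul_of_nonneg_left h1 hK.le
      linarith
    · have h1 : deriv (radialDeriv φ) r ≤ 1 / (16 * K) * radialDeriv φ r ^ 2 := hsub ⟨hgt, hr.2⟩
      have h3 := mul_le_mul_of_nonneg_left h1 hK.le
      have h4 : K * (1 / (16 * K) * radialDeriv φ r ^ 2) = 1 / 16 * radialDeriv φ r ^ 2 := by
        field_simp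
      nlinarith
  have hderiv : ∀ r ∈ Ico (0 : ℝ) 1, HasDerivAt (fun r => K / (N + radialDeriv φ r))
      (-(K * deriv (radialDeriv φ) r) / (N + radialDeriv φ r) ^ 2) r := by
    intro r hr
    have h1 := (hφ.hasDerivAt_radialDeriv (Ico_zero_one_subset hr)).const_add N
    exact ((hasDerivAt_const r K).fun_div h1 (hD r hr).ne').congr_deriv (by ring)
  have hlip : ∀ r ∈ Ico (0 : ℝ) 1, ∀ t ∈ Ico (0 : ℝ) 1,
      |K / (N + radialDeriv φ r) - K / (N + radialDeriv φ t)| ≤ |r - t| / 16 := by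
    intro r hr t ht
    have := Convex.norm_image_sub_le_of_norm_hasDerivWithin_le (C := 1 / 16)
      (fun x hx => (hderiv x hx).hasDerivWithinAt) (fun x hx => ?_) (convex_Ico 0 1) ht hr
    · rw [Real.norm_eq_abs, Real.norm_eq_abs] at this
      linarith
    · have h0 := hφ.deriv_radialDeriv_nonneg hx
      have hDx := hD x hx
      rw [norm_div, norm_neg, Real.norm_of_nonneg (by positivity),
        Real.norm_of_nonneg (by positivity), div_le_iff₀ (by positivity)]
      exact hbound x hx
  have hanti : AntitoneOn (fun r => K / (N + radialDeriv φ r)) (Ico 0 1) := by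
    intro r hr t ht hrt
    have h1 := hφ.monotoneOn_radialDeriv hr ht hrt
    have h2 := hD r hr
    simp only
    gcongr
  have hlim : Tendsto (fun r => K / (N + radialDeriv φ r)) (𝓝[<] 1) (𝓝 0) :=
    (tendsto_atTop_add_const_left _ N hφ.tendsto_radialDeriv).const_div_atTop K
  have hdiff : ∀ r ∈ Ico (0 : ℝ) 1, DifferentiableAt ℝ (fun r : ℝ => φ (r : ℂ)) r := fun r hr =>
    (hφ.hasDerivAt_profile (Ico_zero_one_subset hr)).differentiableAt
  refine ⟨N, hN1, ⟨fun r hr => div_pos hK (hD r hr), hlip, fun r hr => ?_, hanti,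
    fun r hr => (hderiv r ⟨hr.1.le, hr.2⟩).differentiableAt, ?_, ?_, ?_⟩⟩
  · have h1 : Tendsto (fun t => K / (N + radialDeriv φ t) + (1 - r) / 16) (𝓝[<] 1)
        (𝓝 (0 + (1 - r) / 16)) := hlim.add_const _
    rw [zero_add] at h1
    refine ge_of_tendsto h1 ?_
    filter_upwards [Ioo_mem_nhdsLT hr.2] with t ht
    have h2 := (abs_le.1 (hlip r hr t ⟨hr.1.trans ht.1.le, ht.2⟩)).2
    rw [abs_sub_comm, abs_of_pos (sub_pos.2 ht.1)] at h2
    linarith [ht.2]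
  · exact ContinuousOn.add (fun r hr => (hdiff r hr).continuousAt.continuousWithinAt)
      (continuous_const.mul continuous_id).continuousOn
  · intro t r ht htr hr
    have htm : t ∈ Ico (0 : ℝ) 1 := ⟨ht, htr.trans_lt hr⟩
    have h0 := hD t htm
    rcases htr.eq_or_lt with rfl | hlt
    · simp
    have h1 := hφ.convex.deriv_le_slope htm ⟨ht.trans htr, hr⟩ hlt (hdiff t htm)
    rw [slope_def_field, le_div_iff₀ (by linarith)] at h1
    have h2 : K * ((r - t) / (K / (N + radialDeriv φ t))) = (r - t) * (N + radialDeriv φ t) := by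
      field_simp
    have h3 : radialDeriv φ t = deriv (fun r : ℝ => φ (r : ℂ)) t := rfl
    rw [h2, h3]
    linarith
  · intro t r ht htr hr
    have hrm : r ∈ Ico (0 : ℝ) 1 := ⟨ht.trans htr, hr⟩
    have h0 := hD r hrm
    rcases htr.eq_or_lt with rfl | hlt
    · simp
    have h1 := hφ.convex.slope_le_deriv ⟨ht, htr.trans_lt hr⟩ hrm hlt (hdiff r hrm)
    rw [slope_def_field, div_le_iff₀ (by linarith)] at h1
    have h2 : K * ((r - t) / (K / (N + radialDeriv φ r))) = (r - t) * (N + radialDeriv φ r) := by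
      field_simp
    have h3 : radialDeriv φ r = deriv (fun r : ℝ => φ (r : ℂ)) r := rfl
    rw [h2, h3]
    linarith

end IsSmoothRapidlyDecreasing

/-! ### Regularising the modulus of a Bloch-type function -/

namespace IsRadialScale

theorem closedBall_subset_disc (h : IsRadialScale K Φ η) {z : ℂ} (hz : z ∈ disc) :
    Metric.closedBall z (4 * η ‖z‖) ⊆ disc :=
  (Metric.closedBall_subset_ball (by linarith [h.pos_norm hz])).trans (h.ball_subset_disc hz)

theorem scale_le_two_mul (h : IsRadialScale K Φ η) {z w : ℂ} (hz : z ∈ disc)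
    (hw : w ∈ Metric.closedBall z (4 * η ‖z‖)) : η ‖z‖ ≤ 2 * η ‖w‖ := by
  have h1 := (abs_le.1 (h.abs_scale_sub_le hz (h.closedBall_subset_disc hz hw))).2
  rw [mem_closedBall_iff_norm, norm_sub_rev] at hw
  linarith [h.pos_norm hz]

end IsRadialScale

/-- The Bloch-type condition of order `σ + 1` implies the one of order `1`: where `|g| ≥ A` this is
immediate, and elsewhere `|g|` stays below a multiple of `A` on the disc of radius `η`, because
`|g| ^ (σ + 1)` has gradient `O(A ^ (σ + 1) / η)`, so that Cauchy's estimate applies. -/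
theorem norm_deriv_mul_scale_le (h : IsRadialScale K Φ η) {g : ℂ → ℂ}
    (hg : ∀ z ∈ disc, DifferentiableAt ℂ g z) {σ A : ℝ} (hσ : 0 < σ) (hA : 0 < A)
    (hgA : ∀ z ∈ disc, ‖g z‖ ^ σ * ‖deriv g z‖ * η ‖z‖ ≤ A ^ (σ + 1)) {z : ℂ} (hz : z ∈ disc) :
    ‖deriv g z‖ * η ‖z‖ ≤ (1 + 2 * (σ + 1)) * A := by
  have hηz := h.pos_norm hz
  have hAσ : A ^ (σ + 1) = A ^ σ * A := by rw [Real.rpow_add hA, Real.rpow_one]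
  rcases le_total A ‖g z‖ with hle | hle
  · have h1 : A ^ σ ≤ ‖g z‖ ^ σ := Real.rpow_le_rpow hA.le hle hσ.le
    have h2 : A ^ σ * (‖deriv g z‖ * η ‖z‖) ≤ A ^ σ * A := by
      rw [← hAσ]
      refine le_trans ?_ (hgA z hz)
      rw [mul_assoc]
      gcongr
    have h3 := le_of_mul_le_mul_left h2 (by positivity)
    nlinarith
  have hsub : Metric.closedBall z (η ‖z‖) ⊆ Metric.closedBall z (4 * η ‖z‖) :=
    Metric.closedBall_subset_closedBall (by linarith)
  have hd : ∀ w ∈ Metric.closedBall z (η ‖z‖), w ∈ disc := fun w hw =>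
    h.closedBall_subset_disc hz (hsub hw)
  have hgrow : ∀ w ∈ Metric.closedBall z (η ‖z‖), ‖g w‖ ≤ (1 + 2 * (σ + 1)) * A := by
    intro w hw
    have hder : ∀ x ∈ Metric.closedBall z (η ‖z‖), HasFDerivWithinAt (fun y => ‖g y‖ ^ (σ + 1))
        ((fderiv ℝ (fun y : ℂ => ‖y‖ ^ (σ + 1)) (g x)).comp (fderiv ℝ g x))
        (Metric.closedBall z (η ‖z‖)) x := fun x hx =>
      (HasFDerivAt.comp x (differentiable_norm_rpow (by linarith) (g x)).hasFDerivAt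
        ((hg x (hd x hx)).restrictScalars ℝ).hasFDerivAt).hasFDerivWithinAt
    have hbd : ∀ x ∈ Metric.closedBall z (η ‖z‖),
        ‖(fderiv ℝ (fun y : ℂ => ‖y‖ ^ (σ + 1)) (g x)).comp (fderiv ℝ g x)‖ ≤
          2 * (σ + 1) * A ^ (σ + 1) / η ‖z‖ := by
      intro x hx
      have hηx := h.pos_norm (hd x hx)
      have h1 : ‖fderiv ℝ g x‖ = ‖deriv g x‖ := by
        rw [((hg x (hd x hx)).hasDerivAt.hasFDerivAt.restrictScalars ℝ).fderiv]
        simp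
      refine (ContinuousLinearMap.opNorm_comp_le _ _).trans ?_
      have h2 := norm_fderiv_norm_id_rpow (g x) (p := σ + 1) (by linarith)
      rw [h1, h2, add_sub_cancel_right, le_div_iff₀ hηz]
      calc (σ + 1) * ‖g x‖ ^ σ * ‖deriv g x‖ * η ‖z‖
          ≤ (σ + 1) * ‖g x‖ ^ σ * ‖deriv g x‖ * (2 * η ‖x‖) := by
            have := h.scale_le_two_mul hz (hsub hx)
            gcongr
        _ = 2 * (σ + 1) * (‖g x‖ ^ σ * ‖deriv g x‖ * η ‖x‖) := by ring
        _ ≤ _ := by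
            have := hgA x (hd x hx)
            gcongr
    have hmv := (convex_closedBall z (η ‖z‖)).norm_image_sub_le_of_norm_hasFDerivWithin_le hder hbd
      (Metric.mem_closedBall_self hηz.le) hw
    have h3 : ‖g w‖ ^ (σ + 1) ≤ (1 + 2 * (σ + 1)) * A ^ (σ + 1) := by
      have h4 : 2 * (σ + 1) * A ^ (σ + 1) / η ‖z‖ * ‖w - z‖ ≤ 2 * (σ + 1) * A ^ (σ + 1) := by
        rw [mem_closedBall_iff_norm] at hw
        rw [div_mul_eq_mul_div, div_le_iff₀ hηz]
        gcongr
      have h5 : ‖g z‖ ^ (σ + 1) ≤ A ^ (σ + 1) :=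
        Real.rpow_le_rpow (norm_nonneg _) hle (by linarith)
      have h6 := (le_abs_self _).trans hmv
      linarith
    refine (Real.rpow_le_rpow_iff (norm_nonneg _) (by positivity)
      (show 0 < σ + 1 by linarith)).1 (h3.trans ?_)
    rw [Real.mul_rpow (by positivity) hA.le]
    gcongr
    exact Real.self_le_rpow_of_one_le (by linarith) (by linarith)
  have hcauchy := Complex.norm_deriv_le_of_forall_mem_sphere_norm_le hηz
    (f := g) (c := z) (C := (1 + 2 * (σ + 1)) * A) ?_
    fun w hw => hgrow w (Metric.sphere_subset_closedBall hw)
  · rwa [le_div_iff₀ hηz] at hcauchy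
  · exact DifferentiableOn.diffContOnCl_ball (U := disc) (fun w hw =>
      (hg w hw).differentiableWithinAt) fun w hw => hd w hw

/-- The regularised modulus `max |g| A` varies slowly at the scale `η`, the more so the larger `A`
is compared with `η |g'|`. -/
theorem max_norm_le_mul_max_norm (h : IsRadialScale K Φ η) {g : ℂ → ℂ}
    (hg : ∀ z ∈ disc, DifferentiableAt ℂ g z) {A c : ℝ} (hA : 0 < A) (hc : 0 ≤ c)
    (hgA : ∀ z ∈ disc, ‖deriv g z‖ * η ‖z‖ ≤ c * A) {z w : ℂ} (hz : z ∈ disc)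
    (hzw : ‖z - w‖ ≤ 4 * η ‖z‖) :
    max ‖g z‖ A ≤ (1 + 8 * c) * max ‖g w‖ A := by
  have hηz := h.pos_norm hz
  have hw : w ∈ Metric.closedBall z (4 * η ‖z‖) := by
    rwa [mem_closedBall_iff_norm, norm_sub_rev]
  have hmv := (convex_closedBall z (4 * η ‖z‖)).norm_image_sub_le_of_norm_hasDerivWithin_le
    (C := 2 * c * A / η ‖z‖)
    (fun x hx => (hg x (h.closedBall_subset_disc hz hx)).hasDerivAt.hasDerivWithinAt)
    (fun x hx => ?_) hw (Metric.mem_closedBall_self (by positivity))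
  · have h1 : 2 * c * A / η ‖z‖ * ‖z - w‖ ≤ 8 * c * A := by
      rw [div_mul_eq_mul_div, div_le_iff₀ hηz]
      calc 2 * c * A * ‖z - w‖ ≤ 2 * c * A * (4 * η ‖z‖) := by gcongr
        _ = _ := by ring
    have h2 := norm_sub_norm_le (g z) (g w)
    have h3 : 8 * c * A ≤ 8 * c * max ‖g w‖ A := by
      gcongr
      exact le_max_right _ _
    have h4 := le_max_left ‖g w‖ A
    have h5 := le_max_right ‖g w‖ A
    have h6 : 0 ≤ 8 * c * A := by positivity
    refine max_le ?_ ?_ <;> linarith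
  · have h1 := hgA x (h.closedBall_subset_disc hz hx)
    have h2 := h.scale_le_two_mul hz hx
    rw [le_div_iff₀ hηz]
    calc ‖deriv g x‖ * η ‖z‖ ≤ ‖deriv g x‖ * (2 * η ‖x‖) := by gcongr
      _ ≤ _ := by linarith

/-- The slowly varying majorant of `|g|`: at every point it dominates `|g|`, still satisfies the
Bloch-type condition together with `g'`, and its powers up to the exponent `q` vary by a factor at
most `2` over discs of radius `4 η`. The constant `M` does not depend on `g`. -/
theorem exists_regularised_modulus (σ q : ℝ) (hσ : 0 < σ) (hq : 0 < q) :
    ∃ M : ℝ, 1 ≤ M ∧ ∀ (K : ℝ) (Φ η : ℝ → ℝ), IsRadialScale K Φ η → ∀ g : ℂ → ℂ,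
      (∀ z ∈ disc, DifferentiableAt ℂ g z) → ∀ A : ℝ, 0 < A →
      (∀ z ∈ disc, ‖g z‖ ^ σ * ‖deriv g z‖ * η ‖z‖ ≤ A ^ (σ + 1)) →
      (∀ z ∈ disc, max ‖g z‖ (M * A) ^ σ * ‖deriv g z‖ * η ‖z‖ ≤
        M ^ σ * (1 + 2 * (σ + 1)) * A ^ (σ + 1)) ∧
      ∀ z ∈ disc, ∀ w, ‖z - w‖ ≤ 4 * η ‖z‖ → ∀ a, 0 ≤ a → a ≤ q →
        max ‖g z‖ (M * A) ^ a ≤ 2 * max ‖g w‖ (M * A) ^ a := by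
  -- `M` is chosen so that `(1 + 8 c / M) ^ q ≤ 2`, with `c` from `norm_deriv_mul_scale_le`
  set c := 1 + 2 * (σ + 1) with hc
  have hcpos : 1 ≤ c := by linarith
  have h2q : 0 < (2 : ℝ) ^ (1 / q) - 1 :=
    sub_pos.2 (Real.one_lt_rpow one_lt_two (by positivity))
  set M := max 1 (8 * c / ((2 : ℝ) ^ (1 / q) - 1)) with hM
  have hM1 : 1 ≤ M := le_max_left _ _
  have hMc : 1 + 8 * (c / M) ≤ (2 : ℝ) ^ (1 / q) := by
    have h1 : 8 * c / ((2 : ℝ) ^ (1 / q) - 1) ≤ M := le_max_right _ _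
    rw [div_le_iff₀ h2q] at h1
    have h2 : 8 * (c / M) ≤ (2 : ℝ) ^ (1 / q) - 1 := by
      rw [← mul_div_assoc, div_le_iff₀ (by linarith)]
      linarith
    linarith
  refine ⟨M, hM1, fun K Φ η h g hg A hA hgA => ⟨fun z hz => ?_, fun z hz w hzw a ha haq => ?_⟩⟩
  · have hηz := h.pos_norm hz
    have hB := norm_deriv_mul_scale_le h hg hσ hA hgA hz
    have hAσ : A ^ (σ + 1) = A ^ σ * A := by rw [Real.rpow_add hA, Real.rpow_one]
    have hMσ : 1 ≤ M ^ σ := Real.one_le_rpow hM1 hσ.le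
    rcases max_cases ‖g z‖ (M * A) with ⟨he, -⟩ | ⟨he, -⟩ <;> rw [he]
    · refine (hgA z hz).trans ?_
      have : 1 ≤ M ^ σ * c := one_le_mul_of_one_le_of_one_le hMσ hcpos
      exact le_mul_of_one_le_left (by positivity) this
    · rw [Real.mul_rpow (by linarith) hA.le, hAσ]
      calc M ^ σ * A ^ σ * ‖deriv g z‖ * η ‖z‖ = M ^ σ * A ^ σ * (‖deriv g z‖ * η ‖z‖) := by ring
        _ ≤ M ^ σ * A ^ σ * (c * A) := by gcongr
        _ = _ := by ring
  · have hMA : 0 < M * A := by positivity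
    have h1 := max_norm_le_mul_max_norm h hg (A := M * A) (c := c / M) hMA (by positivity)
      (fun x hx => by
        have := norm_deriv_mul_scale_le h hg hσ hA hgA hx
        have h2 : c / M * (M * A) = c * A := by field_simp
        rwa [h2]) hz hzw
    have hpos : 0 < max ‖g w‖ (M * A) := lt_max_of_lt_right hMA
    calc max ‖g z‖ (M * A) ^ a ≤ ((2 : ℝ) ^ (1 / q) * max ‖g w‖ (M * A)) ^ a := by
          refine Real.rpow_le_rpow (le_max_of_le_left (norm_nonneg _)) (h1.trans ?_) ha
          gcongr
      _ = (2 : ℝ) ^ (1 / q * a) * max ‖g w‖ (M * A) ^ a := by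
          rw [Real.mul_rpow (by positivity) hpos.le, ← Real.rpow_mul (by norm_num)]
      _ ≤ 2 * max ‖g w‖ (M * A) ^ a := by
          gcongr
          calc (2 : ℝ) ^ (1 / q * a) ≤ (2 : ℝ) ^ (1 : ℝ) := by
                apply Real.rpow_le_rpow_of_exponent_le (by norm_num)
                rw [one_div_mul_eq_div, div_le_one hq]
                exact haq
            _ = 2 := Real.rpow_one 2

theorem ofReal_mul_mem_disc {z : ℂ} (hz : z ∈ disc) {t : ℝ} (ht : t ∈ uIcc (0 : ℝ) 1) :
    (t : ℂ) * z ∈ disc := by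
  rw [uIcc_of_le zero_le_one] at ht
  have hz' : ‖z‖ < 1 := by simpa [disc] using hz
  simp only [disc, mem_ball_zero_iff, norm_mul, Complex.norm_real, Real.norm_eq_abs,
    abs_of_nonneg ht.1]
  nlinarith [norm_nonneg z, ht.2]

/-- The paraproduct of analytic functions is analytic on the disc, with `(T_g f)' = f g'`. -/
theorem hasDerivAt_T {g f : ℂ → ℂ} (hg : AnalyticOnNhd ℂ g disc) (hf : AnalyticOnNhd ℂ f disc)
    {z : ℂ} (hz : z ∈ disc) : HasDerivAt (T g f) (f z * deriv g z) z := by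
  have hfg : AnalyticOnNhd ℂ (fun z => f z * deriv g z) disc := hf.mul hg.deriv
  obtain ⟨P, hP⟩ := DifferentiableOn.isExactOn_ball (c := 0) (r := 1) hfg.differentiableOn
  have hT : ∀ w ∈ disc, T g f w = P w - P 0 := by
    intro w hw
    have hseg : ∀ t ∈ uIcc (0 : ℝ) 1, (t : ℂ) * w ∈ disc := fun t => ofReal_mul_mem_disc hw
    have hline : ∀ t : ℝ, HasDerivAt (fun t : ℝ => (t : ℂ) * w) w t := fun t => by
      simpa using (Complex.ofRealCLM.hasDerivAt (x := t)).mul_const w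
    have hint := intervalIntegral.integral_eq_sub_of_hasDerivAt (a := 0) (b := 1)
      (f := fun t : ℝ => P (t * w)) (f' := fun t : ℝ => f (t * w) * deriv g (t * w) * w)
      (fun t ht => (hP _ (hseg t ht)).comp_of_eq t (hline t) rfl) ?_
    · simpa [T] using hint
    · refine ContinuousOn.intervalIntegrable ?_
      exact (hfg.continuousOn.comp (f := fun t : ℝ => (t : ℂ) * w)
        (continuous_iff_continuousAt.2 fun t => (hline t).continuousAt).continuousOn
        hseg).mul continuousOn_const
  refine ((hP z hz).sub_const (P 0)).congr_of_eventuallyEq ?_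
  filter_upwards [isOpen_disc.mem_nhds hz] with w hw using hT w hw

theorem analyticOnNhd_T {g f : ℂ → ℂ} (hg : AnalyticOnNhd ℂ g disc)
    (hf : AnalyticOnNhd ℂ f disc) : AnalyticOnNhd ℂ (T g f) disc :=
  DifferentiableOn.analyticOnNhd
    (fun _ hz => (hasDerivAt_T hg hf hz).differentiableAt.differentiableWithinAt) isOpen_disc

theorem analyticOnNhd_T_iterate {g f : ℂ → ℂ} (hg : AnalyticOnNhd ℂ g disc)
    (hf : AnalyticOnNhd ℂ f disc) (k : ℕ) : AnalyticOnNhd ℂ ((T g)^[k] f) disc := by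
  induction k with
  | zero => exact hf
  | succ k ih =>
    rw [Function.iterate_succ_apply']
    exact analyticOnNhd_T hg ih

theorem T_zero (g f : ℂ → ℂ) : T g f 0 = 0 := by simp [T]

/-! ### The norm estimate -/

theorem weightP_eq (φ : ℂ → ℝ) (p : ℝ) (z : ℂ) : weightP φ p z = Real.exp (-p * φ z) := by
  rw [weightP, weight, ← Real.exp_mul]
  congr 1
  ring

theorem lpNorm_weightP_eq (hφ : ContinuousOn φ disc) {p : ℝ} (hp : 0 < p) {F : ℂ → ℂ}
    (hF : ContinuousOn F disc) :
    lpNorm p (weightP φ p) F = (ENNReal.ofReal (1 / Real.pi) *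
      ∫⁻ z in disc, ENNReal.ofReal (‖F z‖ ^ p * Real.exp (-p * φ z))) ^ (1 / p) := by
  have hw : ContinuousOn (fun z => ENNReal.ofReal (weightP φ p z / Real.pi)) disc := by
    simp only [weightP_eq]
    exact ENNReal.continuous_ofReal.comp_continuousOn
      ((Real.continuous_exp.comp_continuousOn (continuousOn_const.mul hφ)).div_const _)
  rw [lpNorm, eLpNorm_eq_lintegral_rpow_enorm_toReal (by simpa using hp) ENNReal.ofReal_ne_top,
    ENNReal.toReal_ofReal hp.le, weightedArea,
    lintegral_withDensity_eq_lintegral_mul₀ (hw.aemeasurable measurableSet_disc)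
      ((hF.aestronglyMeasurable measurableSet_disc).enorm.pow_const p),
    ← lintegral_const_mul' _ _ ENNReal.ofReal_ne_top]
  congr 1
  refine lintegral_congr fun z => ?_
  rw [Pi.mul_apply, weightP_eq, ← ofReal_norm,
    ENNReal.ofReal_rpow_of_nonneg (norm_nonneg _) hp.le, ← ENNReal.ofReal_mul (by positivity), ← ENNReal.ofReal_mul (by positivity)]
  congr 1
  ring

theorem aestronglyMeasurable_weightedArea (v : ℂ → ℝ) {F : ℂ → ℂ} (hF : ContinuousOn F disc) :
    AEStronglyMeasurable F (weightedArea v) :=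
  (hF.aestronglyMeasurable measurableSet_disc).mono_ac (withDensity_absolutelyContinuous _ _)

theorem analyticOnNhd_disc_of_closedBall {g : ℂ → ℂ}
    (hg : AnalyticOnNhd ℂ g (Metric.closedBall 0 1)) : AnalyticOnNhd ℂ g disc :=
  hg.mono Metric.ball_subset_closedBall

theorem continuousOn_Q {g f : ℂ → ℂ} (hg : AnalyticOnNhd ℂ g disc) (hf : AnalyticOnNhd ℂ f disc)
    {σ : ℚ} (hσ : 0 < σ) (l : ℕ) : ContinuousOn (Q g σ l f) disc := by
  have hσ' : (0 : ℝ) < σ := by exact_mod_cast hσ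
  refine ContinuousOn.mul ?_ (analyticOnNhd_T_iterate hg hf l).continuousOn
  exact Complex.continuous_ofReal.comp_continuousOn
    (hg.continuousOn.norm.rpow_const fun _ _ => Or.inr (by positivity))

theorem norm_Q (g : ℂ → ℂ) (σ : ℚ) (l : ℕ) (f : ℂ → ℂ) (z : ℂ) :
    ‖Q g σ l f z‖ = ‖g z‖ ^ ((σ : ℝ) * l) * ‖(T g)^[l] f z‖ := by
  rw [Q, norm_mul, Complex.norm_real, Real.norm_of_nonneg (by positivity)]

/-- The gradient of `|g| ^ q` has length at least `q |g| ^ (q - 1) |g'|`: this is the derivative in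
the direction in which `g` moves radially. -/
theorem ofReal_le_gradNorm {g : ℂ → ℂ} {z : ℂ} (hg : DifferentiableAt ℂ g z) {σ : ℝ} (hσ : 0 < σ) :
    ENNReal.ofReal ((σ + 1) * ‖g z‖ ^ σ * ‖deriv g z‖) ≤
      gradNorm (fun w => ‖g w‖ ^ (σ + 1)) z := by
  rcases eq_or_ne (g z) 0 with h0 | h0
  · simp [h0, Real.zero_rpow hσ.ne']
  rcases eq_or_ne (deriv g z) 0 with h1 | h1
  · simp [h1]
  -- in the direction `e`, the derivative of `g` is a positive multiple of `g z`
  set e : ℂ := g z / ‖g z‖ * (‖deriv g z‖ / deriv g z) with he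
  have hn0 : (‖g z‖ : ℂ) ≠ 0 := by simpa using h0
  have hen : ‖e‖ = 1 := by
    have a0 : ‖g z‖ ≠ 0 := by simpa using h0
    have a1 : ‖deriv g z‖ ≠ 0 := by simpa using h1
    simp [he, a0, a1]
  have he0 : e ≠ 0 := by
    rintro h
    simp [h] at hen
  have hline : HasDerivAt (fun t : ℝ => z + t * e) e 0 := by
    simpa using ((Complex.ofRealCLM.hasDerivAt (x := 0)).mul_const e).const_add z
  have hgl : HasDerivAt (fun t : ℝ => g (z + t * e)) (deriv g z * e) 0 :=
    hg.hasDerivAt.comp_of_eq (0 : ℝ) hline (by simp)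
  have hψ : HasDerivAt (fun t : ℝ => ‖g (z + t * e)‖ ^ (σ + 1))
      ((σ + 1) * ‖g z‖ ^ σ * ‖deriv g z‖) 0 := by
    have h2 := (hasFDerivAt_norm_rpow (g z) (p := σ + 1) (by linarith)).comp_hasDerivAt_of_eq
      (0 : ℝ) hgl (by simp)
    refine h2.congr_deriv ?_
    have h3 : deriv g z * e = ((‖deriv g z‖ / ‖g z‖ : ℝ) : ℂ) * g z := by
      rw [he]
      push_cast
      field_simp
    have h4 : innerSL ℝ (g z) (deriv g z * e) = ‖deriv g z‖ * ‖g z‖ := by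
      rw [h3, innerSL_apply_apply, ← Complex.real_smul, real_inner_smul_right,
        real_inner_self_eq_norm_sq]
      have : ‖g z‖ ≠ 0 := by simpa using h0
      field_simp
    have hpow : ‖g z‖ ^ σ = ‖g z‖ ^ (σ + 1 - 2) * ‖g z‖ := by
      rw [← Real.rpow_add_one (by simpa using h0)]
      congr 1
      ring
    rw [_root_.smul_apply, h4, hpow, smul_eq_mul]
    ring
  have hslope := (hasDerivAt_iff_tendsto_slope.1 hψ).abs
  have htend : Tendsto (fun t : ℝ => z + t * e) (𝓝[≠] 0) (𝓝[≠] z) := by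
    refine tendsto_nhdsWithin_iff.2 ⟨?_, ?_⟩
    · simpa using hline.continuousAt.tendsto.mono_left nhdsWithin_le_nhds
    · filter_upwards [self_mem_nhdsWithin] with t ht
      simpa [he0] using ht
  have hlim : Tendsto (fun t : ℝ => ENNReal.ofReal
      (|‖g (z + t * e)‖ ^ (σ + 1) - ‖g z‖ ^ (σ + 1)| / ‖(z + t * e) - z‖)) (𝓝[≠] 0)
      (𝓝 (ENNReal.ofReal ((σ + 1) * ‖g z‖ ^ σ * ‖deriv g z‖))) := by
    refine (ENNReal.continuous_ofReal.tendsto _).comp ?_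
    rw [abs_of_nonneg (by positivity)] at hslope
    refine hslope.congr fun t => ?_
    rw [slope_def_field, abs_div]
    simp [hen]
  rw [← hlim.limsup_eq, gradNorm]
  exact limsup_le_limsup_of_le (u := fun w : ℂ => ENNReal.ofReal
    (|‖g w‖ ^ (σ + 1) - ‖g z‖ ^ (σ + 1)| / ‖w - z‖)) htend

theorem T_congr {g f h : ℂ → ℂ} (hfh : EqOn f h disc) : EqOn (T g f) (T g h) disc := by
  intro z hz
  refine intervalIntegral.integral_congr fun t ht => ?_
  simp only [hfh (ofReal_mul_mem_disc hz ht)]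

theorem T_add_smul {g f h : ℂ → ℂ} (hg : AnalyticOnNhd ℂ g disc) (hf : AnalyticOnNhd ℂ f disc)
    (hh : AnalyticOnNhd ℂ h disc) (c : ℂ) :
    EqOn (T g (c • f + h)) (c • T g f + T g h) disc := by
  intro z hz
  have hint : ∀ u : ℂ → ℂ, AnalyticOnNhd ℂ u disc → IntervalIntegrable
      (fun t : ℝ => u (t * z) * deriv g (t * z) * z) volume 0 1 := fun u hu =>
    ContinuousOn.intervalIntegrable (((hu.mul hg.deriv).continuousOn.comp
      (f := fun t : ℝ => (t : ℂ) * z) (by fun_prop) fun t ht => ofReal_mul_mem_disc hz ht).mul continuousOn_const)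
  simp only [T, Pi.add_apply, Pi.smul_apply, smul_eq_mul]
  rw [← intervalIntegral.integral_const_mul, ← intervalIntegral.integral_add
    ((hint f hf).const_mul c) (hint h hh)]
  refine intervalIntegral.integral_congr fun t _ => ?_
  ring

theorem T_iterate_add_smul {g f h : ℂ → ℂ} (hg : AnalyticOnNhd ℂ g disc)
    (hf : AnalyticOnNhd ℂ f disc) (hh : AnalyticOnNhd ℂ h disc) (c : ℂ) (k : ℕ) :
    EqOn ((T g)^[k] (c • f + h)) (c • (T g)^[k] f + (T g)^[k] h) disc := by
  induction k with
  | zero => exact fun _ _ => rfl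
  | succ k ih =>
    simp only [Function.iterate_succ_apply']
    exact (T_congr ih).trans (T_add_smul hg (analyticOnNhd_T_iterate hg hf k)
      (analyticOnNhd_T_iterate hg hh k) c)

theorem Q_add_smul {g f h : ℂ → ℂ} (hg : AnalyticOnNhd ℂ g disc)
    (hf : AnalyticOnNhd ℂ f disc) (hh : AnalyticOnNhd ℂ h disc) (c : ℂ) (σ : ℚ) (l : ℕ) {z : ℂ}
    (hz : z ∈ disc) : Q g σ l (c • f + h) z = c * Q g σ l f z + Q g σ l h z := by
  simp only [Q, T_iterate_add_smul hg hf hh c l hz, Pi.add_apply, Pi.smul_apply, smul_eq_mul]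
  ring

/-- The Bloch-type condition holds for functions analytic up to the boundary, since `φ' ≥ 0`. -/
theorem exists_bloch_bound (hφ : IsSmoothRapidlyDecreasing φ) {g : ℂ → ℂ}
    (hg : AnalyticOnNhd ℂ g (Metric.closedBall 0 1)) {σ : ℝ} (hσ : 0 < σ) :
    ∃ B : ℝ, 0 < B ∧ ∀ z ∈ disc, ‖g z‖ ^ σ * ‖deriv g z‖ ≤ B * (1 + radialDeriv φ ‖z‖) := by
  have hcont : ContinuousOn (fun z => ‖g z‖ ^ σ * ‖deriv g z‖) (Metric.closedBall 0 1) :=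
    (hg.continuousOn.norm.rpow_const fun _ _ => Or.inr hσ.le).mul hg.deriv.continuousOn.norm
  obtain ⟨B, hB⟩ := (isCompact_closedBall (0 : ℂ) 1).exists_bound_of_continuousOn hcont
  refine ⟨max B 1, by positivity, fun z hz => ?_⟩
  have h1 := (le_abs_self _).trans (hB z (Metric.ball_subset_closedBall hz))
  have h2 := hφ.radialDeriv_nonneg (norm_mem_Ico hz)
  have h3 := le_max_left B 1
  have h4 : 0 < max B 1 := by positivity
  nlinarith

/-- One application of the paraproduct, measured against the regularised modulus `H` of `g`. -/
theorem lintegral_T_le {K : ℝ} {Φ η : ℝ → ℝ} (h : IsRadialScale K Φ η) (hK : 0 ≤ K) {p : ℝ}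
    (hp : 0 < p) (hKp : 8 * 2 ^ p ≤ Real.exp (p * K / 2)) {g f : ℂ → ℂ}
    (hg : AnalyticOnNhd ℂ g disc) (hf : AnalyticOnNhd ℂ f disc) {H : ℂ → ℝ}
    (hH : ∀ z ∈ disc, 0 < H z) (hHc : ContinuousOn H disc) {σ : ℝ} (k : ℕ) {D : ℝ}
    (hHD : ∀ z ∈ disc, H z ^ σ * ‖deriv g z‖ * η ‖z‖ ≤ D)
    (hH2 : ∀ z ∈ disc, ∀ w ∈ disc, ‖z - w‖ ≤ 4 * η ‖z‖ →
      H z ^ (p * σ * ((k + 1 : ℕ) : ℝ)) ≤ 2 * H w ^ (p * σ * ((k + 1 : ℕ) : ℝ))) :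
    ∫⁻ z in disc, ENNReal.ofReal (‖T g f z‖ ^ p *
        (H z ^ (p * σ * ((k + 1 : ℕ) : ℝ)) * Real.exp (-p * Φ ‖z‖))) ≤
      ENNReal.ofReal (2 * 2 ^ p * (3 ^ p * 2 ^ p * 144 * (2 * Real.exp (6 * p * K))) * D ^ p) *
      ∫⁻ z in disc, ENNReal.ofReal (‖f z‖ ^ p *
        (H z ^ (p * σ * (k : ℝ)) * Real.exp (-p * Φ ‖z‖))) := by
  have hD : 0 ≤ D := by
    have h0 : (0 : ℂ) ∈ disc := by simp [disc]
    have := h.pos_norm h0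
    have := hH 0 h0
    exact le_trans (by positivity) (hHD 0 h0)
  have hlp := lintegral_norm_rpow_le_deriv h hK hp hKp
    (V := fun z => H z ^ (p * σ * ((k + 1 : ℕ) : ℝ)))
    (fun z hz => Real.rpow_pos_of_pos (hH z hz) _)
    (hHc.rpow_const fun z hz => Or.inl (hH z hz).ne') hH2
    (F := T g f) (F' := fun z => f z * deriv g z) (fun w hw => hasDerivAt_T hg hf hw)
    (hf.mul hg.deriv) (T_zero g f)
  refine hlp.trans ?_
  rw [ENNReal.ofReal_mul (q := D ^ p) (by positivity),
    mul_assoc (ENNReal.ofReal _), ← lintegral_const_mul' (ENNReal.ofReal (D ^ p)) _ ENNReal.ofReal_ne_top]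
  refine mul_le_mul' le_rfl (setLIntegral_mono' measurableSet_disc fun z hz => ?_)
  rw [← ENNReal.ofReal_mul (by positivity)]
  apply ENNReal.ofReal_le_ofReal
  have hHz := hH z hz
  have hηz := h.pos_norm hz
  have h1 : H z ^ (p * σ * ((k + 1 : ℕ) : ℝ)) = (H z ^ σ) ^ p * H z ^ (p * σ * (k : ℝ)) := by
    rw [← Real.rpow_mul hHz.le, ← Real.rpow_add hHz]
    congr 1
    push_cast
    ring
  calc ‖f z * deriv g z‖ ^ p * η ‖z‖ ^ p *
        (H z ^ (p * σ * ((k + 1 : ℕ) : ℝ)) * Real.exp (-p * Φ ‖z‖))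
      = (H z ^ σ * ‖deriv g z‖ * η ‖z‖) ^ p *
        (‖f z‖ ^ p * (H z ^ (p * σ * (k : ℝ)) * Real.exp (-p * Φ ‖z‖))) := by
        rw [h1, norm_mul, Real.mul_rpow (norm_nonneg _) (norm_nonneg _),
          Real.mul_rpow (by positivity) hηz.le, Real.mul_rpow (by positivity) (norm_nonneg _)]
        ring
    _ ≤ D ^ p * (‖f z‖ ^ p * (H z ^ (p * σ * (k : ℝ)) * Real.exp (-p * Φ ‖z‖))) := by
        gcongr
        exact hHD z hz

/-- The norm estimate for `Q_g^{σ,ℓ}` in terms of an upper bound `B` for `|g|^σ |g'| / (1 + φ')`. -/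
theorem exists_lpNorm_Q_le (hφ : IsSmoothRapidlyDecreasing φ) {p : ℝ} (hp : 0 < p) {σ : ℚ}
    (hσ : 0 < σ) {l : ℕ} (hl : 1 ≤ l) :
    ∃ C : ℝ, 0 < C ∧ ∀ g : ℂ → ℂ, AnalyticOnNhd ℂ g disc → ∀ B : ℝ, 0 < B →
      (∀ z ∈ disc, ‖g z‖ ^ (σ : ℝ) * ‖deriv g z‖ ≤ B * (1 + radialDeriv φ ‖z‖)) →
      ∀ f : ℂ → ℂ, AnalyticOnNhd ℂ f disc →
        lpNorm p (weightP φ p) (Q g σ l f) ≤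
          ENNReal.ofReal (C * B ^ l) * lpNorm p (weightP φ p) f := by
  have hσ' : (0 : ℝ) < σ := by exact_mod_cast hσ
  have hl' : (1 : ℝ) ≤ l := by exact_mod_cast hl
  -- `e^{pK/2}` has to beat the losses in `norm_rpow_shift_le`
  set K := 2 / p * Real.log (8 * 2 ^ p) with hKdef
  have h8 : 1 < 8 * (2 : ℝ) ^ p := by
    have := Real.one_le_rpow (one_le_two (α := ℝ)) hp.le
    linarith
  have hK : 0 < K := mul_pos (by positivity) (Real.log_pos h8)
  have hKp : 8 * 2 ^ p ≤ Real.exp (p * K / 2) := by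
    have : p * K / 2 = Real.log (8 * 2 ^ p) := by rw [hKdef]; field_simp
    rw [this, Real.exp_log (by positivity)]
  obtain ⟨N, hN1, hS⟩ := hφ.exists_isRadialScale hK
  obtain ⟨M, hM1, hM⟩ := exists_regularised_modulus σ (p * σ * l) hσ' (by positivity)
  set c₀ := 2 * 2 ^ p * (3 ^ p * 2 ^ p * 144 * (2 * Real.exp (6 * p * K))) with hc₀
  have hc₀pos : 0 < c₀ := by positivity
  set c₁ := M ^ (σ : ℝ) * (1 + 2 * ((σ : ℝ) + 1)) * K with hc₁
  have hc₁pos : 0 < c₁ := by positivity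
  set c₂ := Real.exp (p * N) * (c₀ * c₁ ^ p) ^ l with hc₂
  have hc₂pos : 0 < c₂ := by positivity
  refine ⟨c₂ ^ (1 / p), by positivity, fun g hg B hB hgB f hf => ?_⟩
  set Φ : ℝ → ℝ := fun r => φ (r : ℂ) + N * r with hΦ
  set η : ℝ → ℝ := fun r => K / (N + radialDeriv φ r) with hη
  -- `A` is the size of `|g|` that corresponds to the bound `K B` on `|g|^σ |g'| η`
  set A := (K * B) ^ (1 / ((σ : ℝ) + 1)) with hA
  have hApos : 0 < A := by positivity
  have hAs : A ^ ((σ : ℝ) + 1) = K * B := by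
    rw [hA, ← Real.rpow_mul (by positivity), one_div_mul_cancel (by positivity), Real.rpow_one]
  have hgA : ∀ z ∈ disc, ‖g z‖ ^ (σ : ℝ) * ‖deriv g z‖ * η ‖z‖ ≤ A ^ ((σ : ℝ) + 1) := by
    intro z hz
    have h1 := hφ.radialDeriv_nonneg (norm_mem_Ico hz)
    have h2 := hgB z hz
    rw [hAs, hη]
    dsimp only
    rw [← mul_div_assoc, div_le_iff₀ (by linarith)]
    calc ‖g z‖ ^ (σ : ℝ) * ‖deriv g z‖ * K ≤ B * (1 + radialDeriv φ ‖z‖) * K := by gcongr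
      _ ≤ B * (N + radialDeriv φ ‖z‖) * K := by gcongr
      _ = _ := by ring
  obtain ⟨hHD, hH2⟩ := hM K Φ η hS g (fun z hz => (hg z hz).differentiableAt) A hApos hgA
  set H : ℂ → ℝ := fun z => max ‖g z‖ (M * A) with hHdef
  have hHpos : ∀ z, 0 < H z := fun z => lt_max_of_lt_right (by positivity)
  have hHc : ContinuousOn H disc := hg.continuousOn.norm.sup continuousOn_const
  set J : ℕ → ℝ≥0∞ := fun k => ∫⁻ z in disc, ENNReal.ofReal (‖(T g)^[k] f z‖ ^ p *
    (H z ^ (p * σ * (k : ℝ)) * Real.exp (-p * Φ ‖z‖))) with hJ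
  have hstep : ∀ k, k ≤ l → J k ≤ ENNReal.ofReal ((c₀ * (c₁ * B) ^ p) ^ k) * J 0 := by
    intro k
    induction k with
    | zero => intro _; simp
    | succ k ih =>
      intro hk
      have hk' : ((k + 1 : ℕ) : ℝ) ≤ l := by exact_mod_cast hk
      have h1 := lintegral_T_le hS hK.le hp hKp hg (analyticOnNhd_T_iterate hg hf k)
        (fun z _ => hHpos z) hHc (σ := σ) k (D := c₁ * B)
        (fun z hz => (hHD z hz).trans (le_of_eq (by rw [hAs, hc₁]; ring)))
        fun z hz w _ hzw => hH2 z hz w hzw _ (by positivity) (by gcongr)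
      have h2 : J (k + 1) ≤ ENNReal.ofReal (c₀ * (c₁ * B) ^ p) * J k := by
        simp only [hJ, Function.iterate_succ_apply']
        exact h1
      refine h2.trans ((mul_le_mul' le_rfl (ih (by omega))).trans (le_of_eq ?_))
      rw [← mul_assoc, ← ENNReal.ofReal_mul (by positivity), pow_succ, mul_comm ((_ : ℝ) ^ k)]
  have hφΦ : ∀ z ∈ disc, φ z = Φ ‖z‖ - N * ‖z‖ := fun z hz => by
    rw [hφ.eq_profile_norm hz, hΦ]
    ring
  have hQJ : ∫⁻ z in disc, ENNReal.ofReal (‖Q g σ l f z‖ ^ p * Real.exp (-p * φ z)) ≤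
      ENNReal.ofReal (Real.exp (p * N)) * J l := by
    rw [hJ, ← lintegral_const_mul' _ _ ENNReal.ofReal_ne_top]
    refine setLIntegral_mono' measurableSet_disc fun z hz => ?_
    rw [← ENNReal.ofReal_mul (by positivity)]
    apply ENNReal.ofReal_le_ofReal
    have h1 : ‖Q g σ l f z‖ ^ p ≤ ‖(T g)^[l] f z‖ ^ p * H z ^ (p * σ * (l : ℝ)) := by
      rw [norm_Q, Real.mul_rpow (by positivity) (by positivity), mul_comm,
        ← Real.rpow_mul (norm_nonneg _)]
      gcongr
      rw [show (σ : ℝ) * l * p = p * σ * l by ring]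
      exact Real.rpow_le_rpow (norm_nonneg _) (le_max_left _ _) (by positivity)
    have h2 : Real.exp (-p * φ z) ≤ Real.exp (p * N) * Real.exp (-p * Φ ‖z‖) := by
      rw [← Real.exp_add]
      apply Real.exp_le_exp.2
      rw [hφΦ z hz]
      have h3 : N * ‖z‖ ≤ N * 1 := by
        have := (norm_mem_Ico hz).2.le
        gcongr
      nlinarith
    have := hHpos z
    calc ‖Q g σ l f z‖ ^ p * Real.exp (-p * φ z)
        ≤ ‖(T g)^[l] f z‖ ^ p * H z ^ (p * σ * (l : ℝ)) *
          (Real.exp (p * N) * Real.exp (-p * Φ ‖z‖)) := by gcongr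
      _ = _ := by ring
  have hJ0 : J 0 ≤ ∫⁻ z in disc, ENNReal.ofReal (‖f z‖ ^ p * Real.exp (-p * φ z)) := by
    refine setLIntegral_mono' measurableSet_disc fun z hz => ?_
    apply ENNReal.ofReal_le_ofReal
    simp only [Function.iterate_zero, id, Nat.cast_zero, mul_zero, Real.rpow_zero, one_mul]
    gcongr ‖f z‖ ^ p * Real.exp ?_
    rw [hφΦ z hz]
    have : 0 ≤ N * ‖z‖ := by positivity
    nlinarith
  have hX : ∫⁻ z in disc, ENNReal.ofReal (‖Q g σ l f z‖ ^ p * Real.exp (-p * φ z)) ≤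
      ENNReal.ofReal (c₂ * (B ^ l) ^ p) *
        ∫⁻ z in disc, ENNReal.ofReal (‖f z‖ ^ p * Real.exp (-p * φ z)) := by
    refine hQJ.trans ((mul_le_mul' le_rfl ((hstep l le_rfl).trans
      (mul_le_mul' le_rfl hJ0))).trans (le_of_eq ?_))
    rw [← mul_assoc, ← ENNReal.ofReal_mul (by positivity), hc₂,
      Real.mul_rpow hc₁pos.le hB.le, ← mul_assoc c₀, mul_pow, ← mul_assoc, ← Real.rpow_natCast
      (B ^ p) l, ← Real.rpow_natCast B l, ← Real.rpow_mul hB.le, ← Real.rpow_mul hB.le,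
      mul_comm p (l : ℝ)]
  have hφc : ContinuousOn φ disc := hφ.contDiff.continuousOn
  rw [lpNorm_weightP_eq hφc hp (continuousOn_Q hg hf hσ l),
    lpNorm_weightP_eq hφc hp hf.continuousOn]
  have hCB : ENNReal.ofReal (c₂ ^ (1 / p) * B ^ l) =
      ENNReal.ofReal (c₂ * (B ^ l) ^ p) ^ (1 / p) := by
    rw [ENNReal.ofReal_rpow_of_nonneg (by positivity) (by positivity),
      Real.mul_rpow hc₂pos.le (by positivity), ← Real.rpow_mul (by positivity),
      mul_one_div_cancel hp.ne', Real.rpow_one]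
  rw [hCB, ← ENNReal.mul_rpow_of_nonneg _ _ (by positivity)]
  refine ENNReal.rpow_le_rpow ?_ (by positivity)
  rw [mul_left_comm]
  exact mul_le_mul' le_rfl hX

theorem isBoundedOperator_Q (hφ : IsSmoothRapidlyDecreasing φ) {p : ℝ} (hp : 0 < p) {σ : ℚ}
    (hσ : 0 < σ) {l : ℕ} (hl : 1 ≤ l) {g : ℂ → ℂ}
    (hg : AnalyticOnNhd ℂ g (Metric.closedBall 0 1)) :
    IsBoundedOperator p (weightP φ p) (Q g σ l) := by
  have hgd := analyticOnNhd_disc_of_closedBall hg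
  obtain ⟨C, hC, hCB⟩ := exists_lpNorm_Q_le hφ hp hσ hl
  obtain ⟨B, hB, hgB⟩ := exists_bloch_bound hφ hg (σ := σ) (by exact_mod_cast hσ)
  have hmain : ∀ f ∈ bergman p (weightP φ p), lpNorm p (weightP φ p) (Q g σ l f) ≤
      ENNReal.ofReal (C * B ^ l) * lpNorm p (weightP φ p) f := fun f hf =>
    hCB g hgd B hB hgB f hf.1
  have h0 : AnalyticOnNhd ℂ (0 : ℂ → ℂ) disc := fun _ _ => analyticAt_const
  refine ⟨fun f hf => ⟨aestronglyMeasurable_weightedArea _ (continuousOn_Q hgd hf.1 hσ l),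
    (hmain f hf).trans_lt (ENNReal.mul_lt_top ENNReal.ofReal_lt_top hf.2.2)⟩,
    fun f hf h hh z hz => ?_, fun c f hf z hz => ?_, (C * B ^ l).toNNReal, hmain⟩
  · simpa using Q_add_smul hgd hf.1 hh.1 1 σ l hz
  · have h1 := Q_add_smul hgd hf.1 h0 c σ l hz
    have h2 := Q_add_smul hgd h0 h0 1 σ l hz
    simp only [smul_zero, add_zero, one_mul] at h1 h2
    rw [h1]
    simpa using h2

end Paraproduct

end

theorem mainTheorem7 (φ : ℂ → ℝ) (hφ : Paraproduct.IsSmoothRapidlyDecreasing φ)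
    (p : ℝ) (hp : 0 < p) (σ : ℚ) (hσ : 0 < σ) (l : ℕ) (hl : 1 ≤ l) :
    ∃ C : ℝ, 0 < C ∧ ∀ g : ℂ → ℂ, AnalyticOnNhd ℂ g (Metric.closedBall 0 1) →
      Paraproduct.IsBoundedOperator p (Paraproduct.weightP φ p) (Paraproduct.Q g σ l) ∧
      Paraproduct.opNorm p (Paraproduct.weightP φ p) (Paraproduct.Q g σ l) ≤
        ENNReal.ofReal C *
          Paraproduct.blochNorm φ ((σ : ℝ) + 1) g ^ (((σ : ℝ) + 1) * (l : ℝ)) := by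
  open Paraproduct in
  have hσ' : (0 : ℝ) < σ := by exact_mod_cast hσ
  have hl' : (0 : ℝ) < l := by exact_mod_cast hl
  obtain ⟨C, hC, hCB⟩ := exists_lpNorm_Q_le hφ hp hσ hl
  refine ⟨C, hC, fun g hg => ⟨isBoundedOperator_Q hφ hp hσ hl hg, ?_⟩⟩
  have hgd := analyticOnNhd_disc_of_closedBall hg
  rw [blochNorm, ← ENNReal.rpow_mul, ← mul_assoc, one_div_mul_cancel (by positivity), one_mul]
  set b : ℝ≥0∞ := ⨆ z ∈ disc, gradNorm (fun w => ‖g w‖ ^ ((σ : ℝ) + 1)) z /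
    ENNReal.ofReal (1 + radialDeriv φ ‖z‖) with hb
  rcases eq_or_ne b ⊤ with htop | htop
  · rw [htop, ENNReal.top_rpow_of_pos hl', ENNReal.mul_top (by simpa using hC)]
    exact le_top
  have hgb : ∀ z ∈ disc, ‖g z‖ ^ (σ : ℝ) * ‖deriv g z‖ ≤ b.toReal * (1 + radialDeriv φ ‖z‖) := by
    intro z hz
    have h1 := hφ.radialDeriv_nonneg (norm_mem_Ico hz)
    have h2 : ENNReal.ofReal (‖g z‖ ^ (σ : ℝ) * ‖deriv g z‖) /
        ENNReal.ofReal (1 + radialDeriv φ ‖z‖) ≤ b := by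
      refine le_trans ?_ (le_iSup₂_of_le z hz le_rfl)
      gcongr
      refine le_trans (ENNReal.ofReal_le_ofReal ?_)
        (ofReal_le_gradNorm (hgd z hz).differentiableAt hσ')
      rw [mul_assoc]
      exact le_mul_of_one_le_left (by positivity) (by linarith)
    rw [← ENNReal.ofReal_div_of_pos (by linarith), ← ENNReal.ofReal_toReal htop,
      ENNReal.ofReal_le_ofReal_iff ENNReal.toReal_nonneg, div_le_iff₀ (by linarith)] at h2
    exact h2
  refine iSup₂_le fun f hf => ?_
  -- the estimate holds for every `B > b`; let `B` decrease to `b`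
  have hB : ∀ B : ℝ, b.toReal < B →
      lpNorm p (weightP φ p) (Q g σ l f) ≤ ENNReal.ofReal (C * B ^ l) := by
    intro B hbB
    have hBpos : 0 < B := ENNReal.toReal_nonneg.trans_lt hbB
    have h1 := hCB g hgd B hBpos (fun z hz => (hgb z hz).trans (by
      have := hφ.radialDeriv_nonneg (norm_mem_Ico hz)
      gcongr)) f hf.1.1
    rwa [hf.2, mul_one] at h1
  have hlim : Tendsto (fun B : ℝ => ENNReal.ofReal (C * B ^ l)) (𝓝[>] b.toReal)
      (𝓝 (ENNReal.ofReal (C * b.toReal ^ l))) :=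
    ((ENNReal.continuous_ofReal.comp (by fun_prop : Continuous fun B : ℝ => C * B ^ l)).tendsto
      _).mono_left nhdsWithin_le_nhds
  have hfin := ge_of_tendsto hlim (by filter_upwards [self_mem_nhdsWithin] with B hbB using hB B hbB)
  rwa [ENNReal.ofReal_mul hC.le, ENNReal.ofReal_pow ENNReal.toReal_nonneg,
    ENNReal.ofReal_toReal htop, ← ENNReal.rpow_natCast] at hfin
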